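/- Let $\{X_t\}_{t\in\mathbb Z}$ be a strictly stationary, centered real process with $X_t=g(e_t,e_{t-1},\dots)$ for a measurable function $g$ and real i.i.d. random variables $\{e_t\}_{t\in\mathbb Z}$ with mean $0$ and variance $0<\sigma_e^2<\infty$. Assume that $E|X_t|^m<\infty$ for some $m>16$ and that, with $\|Z\|_m=(E|Z|^m)^{1/m}$ and $\{e'_t\}$ an independent copy of $\{e_t\}$, $$\delta_m(k):=\big\|X_t-g(e_t,\dots,e_{t-k+1},e'_{t-k},e_{t-k-1},\dots)\big\|_m\le C(1+k)^{-\alpha},\qquad k\ge 0,$$ for some $\alpha>3$ and $C<\infty$. Let $K:\mathbb R\to[0,\infty)$ be symmetric and integrable, continuously differentiable and nonincreasing on $[0,\infty)$, with $K(0)=1$ and with integrable and nonnegative Fourier transform. Put $\gamma(j)=\mathrm{Cov}(X_0,X_j)$, $\widehat\gamma(j)=\frac1T\sum_{t=j+1}^T X_tX_{t-j}$, $$\sigma_T(j_1,j_2)=\frac1T\sum_{t=j_1+1}^T\sum_{s=j_2+1}^T E\big[(X_tX_{t-j_1}-\gamma(j_1))(X_sX_{s-j_2}-\gamma(j_2))\big],$$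 $$\widehat\sigma_T(j_1,j_2)=\frac1T\sum_{t=j_1+1}^T\sum_{s=j_2+1}^T K\Big(\frac{t-s}{b_T}\Big)(X_tX_{t-j_1}-\widehat\gamma(j_1))(X_sX_{s-j_2}-\widehat\gamma(j_2)),$$ where empty sums are $0$. Let $M_T\in\mathbb N$ with $M_T\sim T^{a_s}$ for some $a_s>0$, and let $b_T>0$ with $b_T\to\infty$ and $b_T\sim T^{c}$, where $c<\frac12-\frac{8a_s}{m}$; here $u_T\sim v_T$ means that $u_T/v_T$ is bounded away from $0$ and $\infty$ for all large $T$. Then, as $T\to\infty$, $$\sup_{1\le j_1,j_2\le M_T}\big|\widehat\sigma_T(j_1,j_2)-\sigma_T(j_1,j_2)\big|=O_P\Big(\frac1{b_T}+\frac{b_TM_T^{8/m}}{\sqrt T}\Big).$$ -/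

import Mathlib

open MeasureTheory ProbabilityTheory Filter Asymptotics
open scoped FourierTransform ENNReal

noncomputable section

namespace LagWindow

variable {Ω : Type*} [MeasurableSpace Ω]

/-- Strict stationarity of a real process indexed by `ℤ`: the law of the whole process is
invariant under time shifts. -/
def StrictlyStationary (P : Measure Ω) (X : ℤ → Ω → ℝ) : Prop :=
  ∀ h : ℤ, P.map (fun ω (t : ℤ) => X (t + h) ω) = P.map (fun ω (t : ℤ) => X t ω)

/-- The past `(e_t, e_{t-1}, e_{t-2}, …)` of the innovations at time `t`. -/
def past (e : ℤ → Ω → ℝ) (t : ℤ) (ω : Ω) : ℕ → ℝ := fun i => e (t - (i : ℤ)) ω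

/-- The dependence coefficient
`δ_m(k) = ‖X_t - g(e_t, …, e_{t-k+1}, e'_{t-k}, e_{t-k-1}, …)‖_m` (computed at time `t`),
where the independent copy `e'` of `e` is realised on the second factor of the
product space `(Ω × Ω, P ⊗ P)`, the processes `e` and `X` living on the first factor. -/
def delta (P : Measure Ω) (e : ℤ → Ω → ℝ) (g : (ℕ → ℝ) → ℝ) (X : ℤ → Ω → ℝ)
    (m : ℝ) (t : ℤ) (k : ℕ) : ℝ≥0∞ :=
  eLpNorm
    (fun p : Ω × Ω =>
      X t p.1 - g (Function.update (past e t p.1) k (e (t - (k : ℤ)) p.2)))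
    (ENNReal.ofReal m) (P.prod P)

/-- The assumption on the observed process: `X` is strictly stationary, centered, a causal
Bernoulli shift `X_t = g(e_t, e_{t-1}, …)` of real i.i.d. innovations with mean zero and positive
finite variance, it has a finite absolute moment of order `m > 16`, and
`δ_m(k) ≤ C (1 + k)^{-α}` for some `α > 3` and `C < ∞`. -/
structure ProcessAssumption (P : Measure Ω) (e : ℤ → Ω → ℝ) (g : (ℕ → ℝ) → ℝ)
    (X : ℤ → Ω → ℝ) (m : ℝ) : Prop where
  measurable_e : ∀ t, Measurable (e t)
  indep_e : iIndepFun e P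
  identDistrib_e : ∀ t, IdentDistrib (e t) (e 0) P P
  memLp_e : MemLp (e 0) 2 P
  mean_e : ∫ ω, e 0 ω ∂P = 0
  variance_e : 0 < variance (e 0) P
  measurable_g : Measurable g
  measurable_X : ∀ t, Measurable (X t)
  repr_X : ∀ t, X t =ᵐ[P] fun ω => g (past e t ω)
  stationary_X : StrictlyStationary P X
  centered_X : ∀ t, ∫ ω, X t ω ∂P = 0
  m_gt : 16 < m
  memLp_X : ∀ t, MemLp (X t) (ENNReal.ofReal m) P
  delta_le : ∃ α : ℝ, 3 < α ∧ ∃ C : ℝ, ∀ (t : ℤ) (k : ℕ),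
    delta P e g X m t k ≤ ENNReal.ofReal (C * (1 + (k : ℝ)) ^ (-α))

/-- The assumption on the kernel `K`. As `K` is real and even, its Fourier transform is
real-valued, so that nonnegativity is that of the real part. -/
structure KernelAssumption (K : ℝ → ℝ) : Prop where
  nonneg : ∀ x, 0 ≤ K x
  symm : ∀ x, K (-x) = K x
  contDiffOn : ContDiffOn ℝ 1 K (Set.Ici 0)
  antitoneOn : AntitoneOn K (Set.Ici 0)
  map_zero : K 0 = 1
  integrable : Integrable K
  integrable_fourier : Integrable (𝓕 (fun x : ℝ => (K x : ℂ)))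
  fourier_nonneg : ∀ ξ : ℝ, 0 ≤ (𝓕 (fun x : ℝ => (K x : ℂ)) ξ).re

/-- The autocovariance `γ(j) = Cov(X_0, X_j)`. -/
def autocov (P : Measure Ω) (X : ℤ → Ω → ℝ) (j : ℕ) : ℝ :=
  covariance (X 0) (X (j : ℤ)) P

/-- The sample autocovariance `γ̂(j) = T⁻¹ ∑_{t=j+1}^T X_t X_{t-j}`. -/
def sampleAutocov (X : ℤ → Ω → ℝ) (T j : ℕ) (ω : Ω) : ℝ :=
  (1 / (T : ℝ)) * ∑ t ∈ Finset.Icc (j + 1) T, X (t : ℤ) ω * X ((t : ℤ) - (j : ℤ)) ω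

/-- `σ_T(j₁,j₂) = T⁻¹ ∑_{t=j₁+1}^T ∑_{s=j₂+1}^T
E[(X_t X_{t-j₁} - γ(j₁)) (X_s X_{s-j₂} - γ(j₂))]`. -/
def sigmaT (P : Measure Ω) (X : ℤ → Ω → ℝ) (T j₁ j₂ : ℕ) : ℝ :=
  (1 / (T : ℝ)) * ∑ t ∈ Finset.Icc (j₁ + 1) T, ∑ s ∈ Finset.Icc (j₂ + 1) T,
    ∫ ω, (X (t : ℤ) ω * X ((t : ℤ) - (j₁ : ℤ)) ω - autocov P X j₁) *
      (X (s : ℤ) ω * X ((s : ℤ) - (j₂ : ℤ)) ω - autocov P X j₂) ∂P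

/-- The estimator `σ̂_T(j₁,j₂) = T⁻¹ ∑_{t=j₁+1}^T ∑_{s=j₂+1}^T
K((t-s)/b) (X_t X_{t-j₁} - γ̂(j₁)) (X_s X_{s-j₂} - γ̂(j₂))`. -/
def sigmaHat (K : ℝ → ℝ) (b : ℝ) (X : ℤ → Ω → ℝ) (T j₁ j₂ : ℕ) (ω : Ω) : ℝ :=
  (1 / (T : ℝ)) * ∑ t ∈ Finset.Icc (j₁ + 1) T, ∑ s ∈ Finset.Icc (j₂ + 1) T,
    K (((t : ℝ) - (s : ℝ)) / b) *
      (X (t : ℤ) ω * X ((t : ℤ) - (j₁ : ℤ)) ω - sampleAutocov X T j₁ ω) *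
      (X (s : ℤ) ω * X ((s : ℤ) - (j₂ : ℤ)) ω - sampleAutocov X T j₂ ω)

/-- `sup_{1 ≤ j₁, j₂ ≤ M} |σ̂_T(j₁,j₂) - σ_T(j₁,j₂)|`, a maximum over a finite index set. -/
def supError (P : Measure Ω) (K : ℝ → ℝ) (b : ℝ) (X : ℤ → Ω → ℝ) (T M : ℕ) (ω : Ω) : ℝ :=
  ⨆ p : ↥(Finset.Icc 1 M ×ˢ Finset.Icc 1 M),
    |sigmaHat K b X T p.1.1 p.1.2 ω - sigmaT P X T p.1.1 p.1.2|

/-- `Z_T = O_P(r_T)` as `T → ∞`: for every `ε > 0` there is a constant `C` with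
`P(|Z_T| > C r_T) ≤ ε` for all large `T`. -/
def IsBigOP (P : Measure Ω) (Z : ℕ → Ω → ℝ) (r : ℕ → ℝ) : Prop :=
  ∀ ε : ℝ, 0 < ε → ∃ C : ℝ, 0 < C ∧
    ∀ᶠ T : ℕ in atTop, P {ω | C * r T < |Z T ω|} ≤ ENNReal.ofReal ε

end LagWindow

end

/-! For each pair of lags the estimator is compared with the deterministic number obtained from σ_T
by inserting the weights K((t-s)/b_T). This number differs from σ_T by O(1/b_T), and σ̂_T differs
from it by O(b_T/√T) in L^{m/4}, both uniformly in the lags (`exists_sigmaHat_bound`). Markov's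
inequality at exponent m/4 and a union bound over M_T² pairs then cost the factor (M_T²)^{4/m} =
M_T^{8/m}.

The tool is resampling. Up to time T the process is a function of the i.i.d. sequence e_T, e_{T-1},
…. Averaging out all coordinates from n on gives a martingale in n, whose increments are bounded by
the effect of resampling one coordinate. If resampling coordinate n moves f by a_n and g by b_n, a
Burkholder inequality gives ‖f - E f‖_q² ≤ B Σ a_n² (`exists_eLpNorm_sub_tailAverage_sq_le`), and
orthogonality of increments gives |Cov(f, g)| ≤ Σ a_n b_n (`enorm_integral_mul_sub_le`).

Fluctuation: by short memory one innovation moves the weighted quadratic form by at most a multiple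
of the row and column sums of the weights, which are O(b_T), while the effects of all innovations
add up to O(T b_T). Hence Σ a_n² = O(T b_T²), which after division by T gives b_T/√T
(`eLpNorm_quadratic_sub_le`). Replacing γ by γ̂, an error of order 1/√T in L^{m/2}, adds nothing
larger (`eLpNorm_estimator_sub_le`).

Bias: the covariance of X_t X_{t-j₁} and X_s X_{s-j₂} decays in |t-s| at a rate free of the lags
(`enorm_integral_centered_mul_le`). Since |K(x) - 1| ≤ L|x|, the bias is at most a multiple of the
first moment of these bounds divided by b_T (`enorm_bias_le`). -/

namespace LagWindow

/-! ### Resampling and tail averages for i.i.d. sequences. -/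

section Splice

variable {α : Type*}

/-- The sequence which agrees with `x` before `n` and with `y` from `n` on. -/
def splice (n : ℕ) (x y : ℕ → α) : ℕ → α := fun i => if i < n then x i else y i

lemma splice_splice_left {n k : ℕ} (h : n ≤ k) (x y z : ℕ → α) :
    splice n (splice k x y) z = splice n x z := by
  funext i
  simp only [splice]
  split_ifs <;> first | rfl | omega

lemma splice_zero (x y : ℕ → α) : splice 0 x y = y := by
  funext i; simp [splice]

lemma update_splice_succ (n : ℕ) (x y : ℕ → α) :
    Function.update (splice (n + 1) x y) n (y n) = splice n x y := by
  funext i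
  simp only [splice, Function.update_apply]
  split_ifs <;> first | rfl | omega | (subst_vars; rfl)

/-- `f` depends only on the first `n` coordinates. -/
def DependsOnFirst (n : ℕ) (f : (ℕ → α) → ℝ) : Prop :=
  ∀ x y, f (splice n x y) = f x

lemma DependsOnFirst.mono {n k : ℕ} (h : n ≤ k) {f : (ℕ → α) → ℝ} (hf : DependsOnFirst n f) :
    DependsOnFirst k f := fun x y => by
  rw [← hf (splice k x y) x, splice_splice_left h, hf]

variable [MeasurableSpace α]

@[fun_prop]
lemma measurable_splice (n : ℕ) :
    Measurable (fun p : (ℕ → α) × (ℕ → α) => splice n p.1 p.2) := by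
  refine measurable_pi_lambda _ fun i => ?_
  simp only [splice]
  split_ifs <;> fun_prop

set_option linter.unusedSectionVars false

variable (ν : Measure α) [IsProbabilityMeasure ν]

/-- The law of an i.i.d. sequence with marginal law `ν`. -/
noncomputable abbrev seqLaw : Measure (ℕ → α) := Measure.infinitePi (fun _ => ν)

lemma measurePreserving_splice (n : ℕ) :
    MeasurePreserving (fun p : (ℕ → α) × (ℕ → α) => splice n p.1 p.2)
      ((seqLaw ν).prod (seqLaw ν)) (seqLaw ν) := by
  refine ⟨measurable_splice n, Measure.eq_infinitePi _ fun s t ht => ?_⟩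
  rw [Measure.map_apply (measurable_splice n)
    (MeasurableSet.pi s.countable_toSet fun i _ => ht i)]
  have : (fun p : (ℕ → α) × (ℕ → α) => splice n p.1 p.2) ⁻¹' (Set.pi s t) =
      (Set.pi ((s.filter (· < n) : Finset ℕ) : Set ℕ) t) ×ˢ
        (Set.pi ((s.filter (¬ · < n) : Finset ℕ) : Set ℕ) t) := by
    ext p
    simp only [Set.mem_preimage, Set.mem_pi, Finset.mem_coe, splice, Set.mem_prod,
      Finset.mem_filter]
    constructor
    · intro h
      refine ⟨fun i hi => ?_, fun i hi => ?_⟩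
      · simpa [hi.2] using h i hi.1
      · simpa [hi.2] using h i hi.1
    · rintro ⟨h1, h2⟩ i hi
      split_ifs with hn
      · exact h1 i ⟨hi, hn⟩
      · exact h2 i ⟨hi, hn⟩
  rw [this, Measure.prod_prod, Measure.infinitePi_pi _ fun i _ => ht i,
    Measure.infinitePi_pi _ fun i _ => ht i, Finset.prod_filter_mul_prod_filter_not]

lemma measurePreserving_update (n : ℕ) :
    MeasurePreserving (fun p : (ℕ → α) × α => Function.update p.1 n p.2)
      ((seqLaw ν).prod ν) (seqLaw ν) := by
  have hm : Measurable (fun p : (ℕ → α) × α => Function.update p.1 n p.2) := by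
    refine measurable_pi_lambda _ fun i => ?_
    simp only [Function.update_apply]
    split_ifs <;> fun_prop
  refine ⟨hm, Measure.eq_infinitePi _ fun s t ht => ?_⟩
  rw [Measure.map_apply hm (MeasurableSet.pi s.countable_toSet fun i _ => ht i)]
  have : (fun p : (ℕ → α) × α => Function.update p.1 n p.2) ⁻¹' (Set.pi s t) =
      (Set.pi ((s.erase n : Finset ℕ) : Set ℕ) t) ×ˢ
        (if n ∈ s then t n else Set.univ) := by
    ext p
    simp only [Set.mem_preimage, Set.mem_pi, Finset.mem_coe, Function.update_apply, Set.mem_prod,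
      Finset.mem_erase]
    constructor
    · intro h
      refine ⟨fun i hi => by simpa [hi.1] using h i hi.2, ?_⟩
      split_ifs with hn
      · simpa using h n hn
      · trivial
    · rintro ⟨h1, h2⟩ i hi
      by_cases hin : i = n
      · subst hin
        simpa [hi] using h2
      · simpa [hin] using h1 i ⟨hin, hi⟩
  rw [this, Measure.prod_prod, Measure.infinitePi_pi _ fun i _ => ht i]
  split_ifs with hn
  · rw [Finset.prod_erase_mul _ _ hn]
  · rw [measure_univ, mul_one, Finset.erase_eq_of_notMem hn]

lemma measurePreserving_eval_snd (n : ℕ) :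
    MeasurePreserving (fun p : (ℕ → α) × (ℕ → α) => (p.1, p.2 n))
      ((seqLaw ν).prod (seqLaw ν)) ((seqLaw ν).prod ν) :=
  (MeasurePreserving.id _).prod (measurePreserving_eval_infinitePi (fun _ => ν) n)

lemma measurePreserving_resample (n : ℕ) :
    MeasurePreserving (fun p : (ℕ → α) × (ℕ → α) => Function.update p.1 n (p.2 n))
      ((seqLaw ν).prod (seqLaw ν)) (seqLaw ν) :=
  (measurePreserving_update ν n).comp (measurePreserving_eval_snd ν n)

/-- Coordinate `n` of `y` is overwritten by `x` in the splice at `n + 1`. Redrawing that coordinate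
therefore leaves the splice unchanged, which makes it independent of the splice. -/
lemma measurePreserving_splice_eval (n : ℕ) :
    MeasurePreserving (fun p : (ℕ → α) × (ℕ → α) => (splice (n + 1) p.1 p.2, p.2 n))
      ((seqLaw ν).prod (seqLaw ν)) ((seqLaw ν).prod ν) := by
  have hm : Measurable (fun p : (ℕ → α) × (ℕ → α) => (splice (n + 1) p.1 p.2, p.2 n)) := by
    fun_prop
  refine ⟨hm, (Measure.prod_eq fun A B hA hB => ?_).symm⟩
  rw [Measure.map_apply hm (hA.prod hB), ← lintegral_indicator_one (hm (hA.prod hB)),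
    lintegral_prod _ (by fun_prop (disch := exact hm (hA.prod hB)))]
  have hmeas : ∀ x : ℕ → α, Measurable (fun y : ℕ → α =>
      ((fun p : (ℕ → α) × (ℕ → α) => (splice (n + 1) p.1 p.2, p.2 n)) ⁻¹' A ×ˢ B).indicator
        (1 : (ℕ → α) × (ℕ → α) → ℝ≥0∞) (x, y)) := fun x =>
    (measurable_one.indicator (hm (hA.prod hB))).comp measurable_prodMk_left
  have key : ∀ x : ℕ → α, ∫⁻ y, ((fun p : (ℕ → α) × (ℕ → α) =>
        (splice (n + 1) p.1 p.2, p.2 n)) ⁻¹' A ×ˢ B).indicator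
        (1 : (ℕ → α) × (ℕ → α) → ℝ≥0∞) (x, y) ∂(seqLaw ν) =
      (∫⁻ y, A.indicator 1 (splice (n + 1) x y) ∂(seqLaw ν)) * ν B := by
    intro x
    rw [← (measurePreserving_update ν n).lintegral_comp (hmeas x)]
    have : ∀ q : (ℕ → α) × α, ((fun p : (ℕ → α) × (ℕ → α) =>
        (splice (n + 1) p.1 p.2, p.2 n)) ⁻¹' A ×ˢ B).indicator
        (1 : (ℕ → α) × (ℕ → α) → ℝ≥0∞) (x, Function.update q.1 n q.2) =
        A.indicator 1 (splice (n + 1) x q.1) * B.indicator 1 q.2 := by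
      intro q
      have h1 : splice (n + 1) x (Function.update q.1 n q.2) = splice (n + 1) x q.1 := by
        funext i
        simp only [splice, Function.update_apply]
        split_ifs <;> first | rfl | omega
      by_cases hA' : splice (n + 1) x q.1 ∈ A <;> by_cases hB' : q.2 ∈ B <;>
        simp [Set.indicator, h1, hA', hB']
    simp_rw [this]
    rw [lintegral_prod_mul (f := fun y => A.indicator 1 (splice (n + 1) x y))
      (g := fun u => B.indicator 1 u), lintegral_indicator_one hB]
    · exact ((measurable_one.indicator hA).comp
        ((measurable_splice (n + 1)).comp measurable_prodMk_left)).aemeasurable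
    · exact (measurable_one.indicator hB).aemeasurable
  simp_rw [key]
  rw [lintegral_mul_const, ← lintegral_indicator_one hA,
    ← (measurePreserving_splice ν (n + 1)).lintegral_comp (measurable_one.indicator hA),
    lintegral_prod]
  · exact ((measurable_one.indicator hA).comp (measurable_splice (n + 1))).aemeasurable
  · exact ((measurable_one.indicator hA).comp (measurable_splice (n + 1))).lintegral_prod_right'

/-- The average of `f` over all coordinates from `n` on. -/
noncomputable def tailAverage (n : ℕ) (f : (ℕ → α) → ℝ) (x : ℕ → α) : ℝ :=
  ∫ y, f (splice n x y) ∂(seqLaw ν)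

/-- The `L^q` distance between `f` and `f` with an independently resampled `n`-th coordinate. -/
noncomputable def resampleNorm (q : ℝ) (f : (ℕ → α) → ℝ) (n : ℕ) : ℝ≥0∞ :=
  eLpNorm (fun p : (ℕ → α) × (ℕ → α) => f p.1 - f (Function.update p.1 n (p.2 n)))
    (ENNReal.ofReal q) ((seqLaw ν).prod (seqLaw ν))

variable {ν}

lemma dependsOnFirst_tailAverage (n : ℕ) (f : (ℕ → α) → ℝ) :
    DependsOnFirst n (tailAverage ν n f) := fun x y => by
  simp only [tailAverage, splice_splice_left le_rfl]

lemma tailAverage_zero (f : (ℕ → α) → ℝ) (x : ℕ → α) :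
    tailAverage ν 0 f x = ∫ y, f y ∂(seqLaw ν) := by
  simp only [tailAverage, splice_zero]

lemma measurable_tailAverage {f : (ℕ → α) → ℝ} (hf : Measurable f) (n : ℕ) :
    Measurable (tailAverage ν n f) :=
  (StronglyMeasurable.integral_prod_right' (f := fun p : (ℕ → α) × (ℕ → α) =>
    f (splice n p.1 p.2)) (hf.comp (measurable_splice n)).stronglyMeasurable).measurable

lemma integrable_comp_splice {f : (ℕ → α) → ℝ} (hf : Integrable f (seqLaw ν)) (n : ℕ) :
    Integrable (fun p : (ℕ → α) × (ℕ → α) => f (splice n p.1 p.2))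
      ((seqLaw ν).prod (seqLaw ν)) :=
  (measurePreserving_splice ν n).integrable_comp_of_integrable hf

/-- The projection property of conditional expectation: `φ` does not see the spliced coordinates, so
it moves inside the inner integral, and Fubini with invariance of the law under splicing finishes.
-/
lemma integral_tailAverage_mul {f φ : (ℕ → α) → ℝ} {n : ℕ} (hφ : DependsOnFirst n φ)
    (hf : Measurable f) (hφm : Measurable φ) (hfφ : Integrable (fun x => f x * φ x) (seqLaw ν)) :
    Integrable (fun x => tailAverage ν n f x * φ x) (seqLaw ν) ∧
      ∫ x, tailAverage ν n f x * φ x ∂(seqLaw ν) = ∫ x, f x * φ x ∂(seqLaw ν) := by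
  have h1 : ∀ x, tailAverage ν n f x * φ x =
      ∫ y, f (splice n x y) * φ (splice n x y) ∂(seqLaw ν) := fun x => by
    simp only [hφ x, integral_mul_const, tailAverage]
  simp_rw [h1]
  have h2 := integrable_comp_splice hfφ n
  refine ⟨h2.integral_prod_left, ?_⟩
  have h3 := integral_map (μ := (seqLaw ν).prod (seqLaw ν)) (measurable_splice (α := α) n).aemeasurable
    (f := fun x => f x * φ x) (hf.mul hφm).aestronglyMeasurable
  rw [← integral_prod _ h2, ← h3, (measurePreserving_splice ν n).map_eq]

/-- Jensen's inequality for averages over a second variable. -/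
lemma eLpNorm_integral_le {β γ : Type*} [MeasurableSpace β] [MeasurableSpace γ]
    {μ : Measure β} {κ : Measure γ} [IsProbabilityMeasure μ] [IsProbabilityMeasure κ]
    {F : β × γ → ℝ} (hF : Measurable F) {q : ℝ} (hq : 1 ≤ q) :
    eLpNorm (fun x => ∫ y, F (x, y) ∂κ) (ENNReal.ofReal q) μ ≤
      eLpNorm F (ENNReal.ofReal q) (μ.prod κ) := by
  have hq0 : 0 < q := by linarith
  have h0 : ENNReal.ofReal q ≠ 0 := by simpa using hq0
  rw [eLpNorm_eq_lintegral_rpow_enorm_toReal h0 ENNReal.ofReal_ne_top,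
    eLpNorm_eq_lintegral_rpow_enorm_toReal h0 ENNReal.ofReal_ne_top,
    ENNReal.toReal_ofReal hq0.le]
  refine ENNReal.rpow_le_rpow ?_ (by positivity)
  rw [lintegral_prod _ (by fun_prop)]
  refine lintegral_mono fun x => ?_
  have h1 : eLpNorm (fun y => F (x, y)) 1 κ ≤ eLpNorm (fun y => F (x, y)) (ENNReal.ofReal q) κ :=
    eLpNorm_le_eLpNorm_of_exponent_le (by simpa using hq)
      (hF.comp measurable_prodMk_left).aestronglyMeasurable
  rw [eLpNorm_eq_lintegral_rpow_enorm_toReal h0 ENNReal.ofReal_ne_top,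
    ENNReal.toReal_ofReal hq0.le, eLpNorm_one_eq_lintegral_enorm] at h1
  calc ‖∫ y, F (x, y) ∂κ‖ₑ ^ q
      ≤ ((∫⁻ y, ‖F (x, y)‖ₑ ^ q ∂κ) ^ (1 / q)) ^ q :=
        ENNReal.rpow_le_rpow ((enorm_integral_le_lintegral_enorm _).trans h1) hq0.le
    _ = ∫⁻ y, ‖F (x, y)‖ₑ ^ q ∂κ := by
        rw [← ENNReal.rpow_mul, one_div_mul_cancel hq0.ne', ENNReal.rpow_one]

lemma eLpNorm_tailAverage_le {f : (ℕ → α) → ℝ} (hf : Measurable f) (n : ℕ) {q : ℝ} (hq : 1 ≤ q) :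
    eLpNorm (tailAverage ν n f) (ENNReal.ofReal q) (seqLaw ν) ≤
      eLpNorm f (ENNReal.ofReal q) (seqLaw ν) := by
  refine (eLpNorm_integral_le (F := fun p : (ℕ → α) × (ℕ → α) => f (splice n p.1 p.2))
    (hf.comp (measurable_splice n)) hq).trans_eq ?_
  exact eLpNorm_comp_measurePreserving hf.aestronglyMeasurable (measurePreserving_splice ν n)

lemma memLp_tailAverage {f : (ℕ → α) → ℝ} (hf : Measurable f) (n : ℕ) {q : ℝ} (hq : 1 ≤ q)
    (h : MemLp f (ENNReal.ofReal q) (seqLaw ν)) :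
    MemLp (tailAverage ν n f) (ENNReal.ofReal q) (seqLaw ν) :=
  ⟨(measurable_tailAverage hf n).aestronglyMeasurable,
    (eLpNorm_tailAverage_le hf n hq).trans_lt h.2⟩

/-- The two splices differ only at coordinate `n`, where the second takes the fresh value `y n`. By
`measurePreserving_splice_eval` the pair is distributed as a sequence and its version resampled at
`n`, so Jensen's inequality gives the bound. -/
lemma eLpNorm_tailAverage_succ_sub_le {f : (ℕ → α) → ℝ} (hf : Measurable f)
    (hfi : Integrable f (seqLaw ν)) (n : ℕ) {q : ℝ} (hq : 1 ≤ q) :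
    eLpNorm (fun x => tailAverage ν (n + 1) f x - tailAverage ν n f x) (ENNReal.ofReal q)
      (seqLaw ν) ≤ resampleNorm ν q f n := by
  have hmu : Measurable (fun p : (ℕ → α) × α => Function.update p.1 n p.2) :=
    (measurePreserving_update ν n).measurable
  have h1 : (fun x => tailAverage ν (n + 1) f x - tailAverage ν n f x) =ᵐ[seqLaw ν]
      fun x => ∫ y, (f (splice (n + 1) x y) - f (splice n x y)) ∂(seqLaw ν) := by
    filter_upwards [(integrable_comp_splice hfi n).prod_right_ae,
      (integrable_comp_splice hfi (n + 1)).prod_right_ae] with x hx hx'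
    rw [integral_sub hx' hx]
    rfl
  rw [eLpNorm_congr_ae h1]
  refine (eLpNorm_integral_le (F := fun p : (ℕ → α) × (ℕ → α) =>
    f (splice (n + 1) p.1 p.2) - f (splice n p.1 p.2)) (by fun_prop) hq).trans_eq ?_
  have h2 : (fun p : (ℕ → α) × (ℕ → α) => f (splice (n + 1) p.1 p.2) - f (splice n p.1 p.2)) =
      (fun r : (ℕ → α) × α => f r.1 - f (Function.update r.1 n r.2)) ∘
        (fun p : (ℕ → α) × (ℕ → α) => (splice (n + 1) p.1 p.2, p.2 n)) := by
    funext p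
    simp only [Function.comp, update_splice_succ]
  have h3 : Measurable (fun r : (ℕ → α) × α => f r.1 - f (Function.update r.1 n r.2)) := by
    fun_prop
  rw [h2, eLpNorm_comp_measurePreserving h3.aestronglyMeasurable
    (measurePreserving_splice_eval ν n), resampleNorm,
    ← eLpNorm_comp_measurePreserving h3.aestronglyMeasurable
    (measurePreserving_eval_snd ν n)]
  rfl

lemma iSup_piLE : ⨆ n, (Filtration.piLE (X := fun _ : ℕ => α)) n = MeasurableSpace.pi := by
  refine le_antisymm (iSup_le fun n => (Filtration.piLE).le n) ?_
  refine iSup_le fun i => le_trans ?_ (le_iSup _ i)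
  have : (fun x : ℕ → α => x i) = (fun z : (Set.Iic i) → α => z ⟨i, Set.self_mem_Iic⟩) ∘
      Preorder.restrictLe i := rfl
  rw [this, ← MeasurableSpace.comap_comp]
  exact MeasurableSpace.comap_mono (measurable_pi_apply _).comap_le

/-- The index shifts by one because `Filtration.piLE` at `n` contains the coordinates 0, …, n, which
are the first `n + 1`. -/
lemma tailAverage_ae_eq_condExp {f : (ℕ → α) → ℝ} (hf : Measurable f)
    (hfi : Integrable f (seqLaw ν)) (n : ℕ) :
    tailAverage ν (n + 1) f =ᵐ[seqLaw ν] (seqLaw ν)[f | Filtration.piLE (X := fun _ : ℕ => α) n] := by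
  have hle := (Filtration.piLE (X := fun _ : ℕ => α)).le n
  have hint : Integrable (tailAverage ν (n + 1) f) (seqLaw ν) := by
    have := (integral_tailAverage_mul (ν := ν) (n := n + 1) (f := f) (φ := fun _ => 1)
      (fun _ _ => rfl) hf measurable_const (by simpa using hfi)).1
    simpa using this
  refine ae_eq_condExp_of_forall_setIntegral_eq hle hfi (fun s _ _ => hint.integrableOn)
    (fun s hs _ => ?_) ?_
  · have hsm := hle _ hs
    have hdep : DependsOnFirst (n + 1) (s.indicator (fun _ => (1 : ℝ))) := by
      obtain ⟨B, -, rfl⟩ := hs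
      intro x y
      have : Preorder.restrictLe (π := fun _ : ℕ => α) n (splice (n + 1) x y) =
          Preorder.restrictLe n x := by
        funext ⟨i, hi⟩
        simp only [Preorder.restrictLe_apply, splice]
        rw [if_pos (Nat.lt_succ_of_le hi)]
      have h2 : splice (n + 1) x y ∈ Preorder.restrictLe (π := fun _ : ℕ => α) n ⁻¹' B ↔
          x ∈ Preorder.restrictLe (π := fun _ : ℕ => α) n ⁻¹' B := by
        rw [Set.mem_preimage, Set.mem_preimage, this]
      by_cases hx : x ∈ Preorder.restrictLe (π := fun _ : ℕ => α) n ⁻¹' B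
      · rw [Set.indicator_of_mem hx, Set.indicator_of_mem (h2.2 hx)]
      · rw [Set.indicator_of_notMem hx, Set.indicator_of_notMem (fun h => hx (h2.1 h))]
    have hmul : ∀ h : (ℕ → α) → ℝ, (fun x => h x * s.indicator (fun _ => (1 : ℝ)) x) =
        s.indicator h := fun h => by
      funext x
      by_cases hx : x ∈ s <;> simp [hx]
    have := (integral_tailAverage_mul (ν := ν) hdep hf (measurable_const.indicator hsm)
      (by rw [hmul]; exact hfi.indicator hsm)).2
    rw [hmul, hmul, integral_indicator hsm, integral_indicator hsm] at this
    exact this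
  · refine StronglyMeasurable.aestronglyMeasurable ?_
    refine Measurable.stronglyMeasurable ?_
    -- Padding with an arbitrary point `a` exhibits the tail average as a measurable function of the
    -- coordinates up to `n`.
    obtain ⟨a⟩ := nonempty_of_isProbabilityMeasure ν
    have hfac : tailAverage ν (n + 1) f = (fun z : (Set.Iic n) → α =>
        tailAverage ν (n + 1) f (fun i => if h : i ≤ n then z ⟨i, h⟩ else a)) ∘
        Preorder.restrictLe n := by
      funext x
      simp only [Function.comp, tailAverage]
      congr 1
      funext y
      congr 1
      funext i
      simp only [splice, Preorder.restrictLe_apply]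
      split_ifs <;> first | rfl | omega
    have hg : Measurable (fun z : (Set.Iic n) → α =>
        tailAverage ν (n + 1) f (fun i => if h : i ≤ n then z ⟨i, h⟩ else a)) := by
      refine (measurable_tailAverage hf (n + 1)).comp (measurable_pi_lambda _ fun i => ?_)
      split_ifs <;> fun_prop
    rw [hfac]
    intro B hB
    exact ⟨_, hg hB, rfl⟩

/-- Lévy's upward theorem, as the coordinate filtration generates the product σ-algebra. -/
lemma tendsto_tailAverage {f : (ℕ → α) → ℝ} (hf : Measurable f)
    (hfi : Integrable f (seqLaw ν)) :
    ∀ᵐ x ∂(seqLaw ν), Tendsto (fun n => tailAverage ν n f x) atTop (nhds (f x)) := by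
  have h1 := hfi.tendsto_ae_condExp (ℱ := Filtration.piLE (X := fun _ : ℕ => α))
    (by rw [iSup_piLE]; exact hf.stronglyMeasurable)
  filter_upwards [h1, ae_all_iff.2 (tailAverage_ae_eq_condExp hf hfi)] with x hx hx'
  rw [← tendsto_add_atTop_iff_nat 1]
  simpa only [hx'] using hx

end Splice

end LagWindow

/-! ### Burkholder and Efron-Stein inequalities in L^q. -/

namespace LagWindow

lemma exp_le_one_add_add_sq {q u : ℝ} (hu : |u| ≤ q) :
    Real.exp u ≤ 1 + u + (Real.exp q + 1) * u ^ 2 := by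
  have hq : 1 ≤ Real.exp q := Real.one_le_exp ((abs_nonneg u).trans hu)
  rcases le_or_gt |u| 1 with h | h
  · have := Real.norm_exp_sub_one_sub_id_le (x := u) h
    rw [Real.norm_eq_abs, Real.norm_eq_abs, sq_abs] at this
    nlinarith [le_abs_self (Real.exp u - 1 - u), sq_nonneg u]
  · have h1 : Real.exp u ≤ Real.exp q := Real.exp_le_exp.2 ((le_abs_self u).trans hu)
    have h2 : |u| ≤ u ^ 2 := by rw [← sq_abs]; nlinarith
    have h3 : 1 ≤ u ^ 2 := by rw [← sq_abs]; nlinarith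
    nlinarith [neg_abs_le u]

/-- A second order Taylor bound for `x ↦ |x| ^ q`. -/
lemma exists_abs_add_rpow_le {q : ℝ} (hq : 2 < q) :
    ∃ c : ℝ, 1 ≤ c ∧ ∀ x y : ℝ, |x + y| ^ q ≤
      |x| ^ q + q * (|x| ^ (q - 2) * x * y) + c * (|x| ^ (q - 2) * y ^ 2 + |y| ^ q) := by
  have hsplit : ∀ z : ℝ, |z| ^ q = |z| ^ (q - 2) * z ^ 2 := fun z => by
    rcases eq_or_ne z 0 with rfl | hz
    · simp [Real.zero_rpow (show q ≠ 0 by linarith)]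
    · rw [← sq_abs, ← Real.rpow_natCast |z| 2, ← Real.rpow_add (abs_pos.2 hz)]
      norm_num
  have h2q : (1 : ℝ) ≤ 2 ^ q := Real.one_le_rpow (by norm_num) (by linarith)
  have hE := Real.exp_pos q
  -- The summand 2^q + q serves the case |x| < |y|, where |y|^q dominates every term; the last
  -- summand serves |y| ≤ |x|, where with t = y/x one has (1 + t)^q ≤ exp(qt), expanded to second
  -- order.
  refine ⟨2 ^ q + q + (Real.exp q + 1) * q ^ 2, by nlinarith [sq_nonneg q], fun x y => ?_⟩
  have hy0 : 0 ≤ |y| ^ q := by positivity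
  have hx0 : 0 ≤ |x| ^ (q - 2) * y ^ 2 := by positivity
  rcases lt_or_ge |x| |y| with h | h
  · have h1 : |x + y| ^ q ≤ 2 ^ q * |y| ^ q := by
      rw [← Real.mul_rpow (by norm_num) (abs_nonneg y)]
      exact Real.rpow_le_rpow (abs_nonneg _) (by linarith [abs_add_le x y]) (by linarith)
    have h2 : -(|x| ^ (q - 2) * x * y) ≤ |y| ^ q := by
      refine (neg_le_abs _).trans ?_
      rw [abs_mul, abs_mul, abs_of_nonneg (by positivity : 0 ≤ |x| ^ (q - 2)), hsplit y,
        ← sq_abs y, sq, ← mul_assoc]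
      gcongr
    have h3 : 0 ≤ |x| ^ q := by positivity
    nlinarith [mul_nonneg (sq_nonneg q) hE.le, mul_nonneg (sq_nonneg q) hy0,
      mul_nonneg (mul_nonneg (sq_nonneg q) hE.le) hy0, mul_nonneg (sq_nonneg q) hx0,
      mul_nonneg (mul_nonneg (sq_nonneg q) hE.le) hx0]
  · rcases eq_or_ne x 0 with rfl | hx
    · have : y = 0 := by simpa using h
      subst this
      simp [Real.zero_rpow (show q ≠ 0 by linarith)]
    set t := y / x with ht
    have hyt : y = t * x := by rw [ht]; field_simp
    have ht1 : |t| ≤ 1 := by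
      rw [ht, abs_div]; exact div_le_one_of_le₀ h (abs_nonneg _)
    have hpos : 0 ≤ 1 + t := by linarith [neg_abs_le t]
    have h1 : |x + y| ^ q = |x| ^ q * (1 + t) ^ q := by
      rw [← Real.mul_rpow (abs_nonneg x) hpos, ← abs_of_nonneg hpos, ← abs_mul, hyt]
      congr 2
      ring
    have h2 : (1 + t) ^ q ≤ 1 + q * t + (Real.exp q + 1) * (q * t) ^ 2 := by
      calc (1 + t) ^ q ≤ (Real.exp t) ^ q :=
            Real.rpow_le_rpow hpos (by linarith [Real.add_one_le_exp t]) (by linarith)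
        _ = Real.exp (q * t) := by rw [← Real.exp_mul, mul_comm]
        _ ≤ _ := exp_le_one_add_add_sq (by
            rw [abs_mul, abs_of_pos (by linarith : 0 < q)]; nlinarith)
    have h3 : |x| ^ q * (1 + t) ^ q ≤ |x| ^ q + q * (|x| ^ (q - 2) * x * y) +
        (Real.exp q + 1) * q ^ 2 * (|x| ^ (q - 2) * y ^ 2) := by
      refine (mul_le_mul_of_nonneg_left h2 (by positivity)).trans_eq ?_
      rw [hsplit x, hyt]
      ring
    rw [h1]
    refine h3.trans ?_
    have : 0 ≤ (2 ^ q + q) * (|x| ^ (q - 2) * y ^ 2) := by positivity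
    have : 0 ≤ (2 ^ q + q + (Real.exp q + 1) * q ^ 2) * |y| ^ q := by positivity
    nlinarith

/-- The average of superadditivity of the power and Bernoulli's inequality. Both gains are needed to
absorb the two error terms of the Taylor bound in `integral_abs_add_rpow_le`. -/
lemma rpow_add_mul_le {p u v : ℝ} (hp : 1 < p) (hu : 0 ≤ u) (hv : 0 ≤ v) :
    u ^ p + (1 / 2) * (u ^ (p - 1) * v + v ^ p) ≤ (u + v) ^ p := by
  have h1 : u ^ p + v ^ p ≤ (u + v) ^ p := Real.add_rpow_le_rpow_add hu hv hp.le
  have h2 : u ^ p + u ^ (p - 1) * v ≤ (u + v) ^ p := by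
    rcases hu.eq_or_lt with rfl | hu'
    · rw [Real.zero_rpow (by linarith), Real.zero_rpow (by linarith)]
      simpa using Real.rpow_nonneg hv p
    · have h3 := one_add_mul_self_le_rpow_one_add
        (show -1 ≤ v / u by linarith [div_nonneg hv hu]) hp.le
      have h4 : u + v = u * (1 + v / u) := by field_simp
      rw [h4, Real.mul_rpow hu (by positivity)]
      have h5 : u ^ p = u ^ (p - 1) * u := by
        rw [← Real.rpow_add_one hu'.ne']; norm_num
      have h6 : 0 ≤ v / u := by positivity
      calc u ^ p + u ^ (p - 1) * v = u ^ p * (1 + v / u) := by rw [h5]; field_simp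
        _ ≤ u ^ p * (1 + p * (v / u)) := by gcongr; nlinarith
        _ ≤ _ := by gcongr
  linarith

lemma rpow_mul_sq_le {q a b : ℝ} (hq : 2 < q) (ha : 0 ≤ a) (hb : 0 ≤ b) :
    a ^ (q - 2) * b ^ 2 ≤ a ^ q + b ^ q := by
  have hsplit : ∀ z : ℝ, 0 ≤ z → z ^ q = z ^ (q - 2) * z ^ 2 := fun z hz => by
    rcases hz.eq_or_lt with rfl | hz
    · simp [Real.zero_rpow (show q ≠ 0 by linarith)]
    · rw [← Real.rpow_natCast z 2, ← Real.rpow_add hz]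
      norm_num
  rcases le_total a b with h | h
  · have : a ^ (q - 2) * b ^ 2 ≤ b ^ q := by
      rw [hsplit b hb]
      gcongr
    linarith [Real.rpow_nonneg ha q]
  · have : a ^ (q - 2) * b ^ 2 ≤ a ^ q := by
      rw [hsplit a ha]
      gcongr
    linarith [Real.rpow_nonneg hb q]

section Moment

variable {β : Type*} [MeasurableSpace β] {μ : Measure β}

lemma MemLp.integrable_abs_rpow {q : ℝ} (hq : 0 < q) {f : β → ℝ}
    (hf : MemLp f (ENNReal.ofReal q) μ) : Integrable (fun x => |f x| ^ q) μ := by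
  have := hf.integrable_norm_rpow (by simpa using hq) ENNReal.ofReal_ne_top
  simpa [ENNReal.toReal_ofReal hq.le] using this

lemma integrable_abs_rpow_mul_sq {q : ℝ} (hq : 2 < q) {S D : β → ℝ}
    (hS : MemLp S (ENNReal.ofReal q) μ) (hD : MemLp D (ENNReal.ofReal q) μ) :
    Integrable (fun x => |S x| ^ (q - 2) * D x ^ 2) μ := by
  refine ((MemLp.integrable_abs_rpow (by linarith) hS).add
    (MemLp.integrable_abs_rpow (by linarith) hD)).mono' ?_ (ae_of_all _ fun x => ?_)
  · have hSm := hS.1.aemeasurable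
    have hDm := hD.1.aemeasurable
    exact AEMeasurable.aestronglyMeasurable (by fun_prop)
  · rw [Real.norm_of_nonneg (by positivity), ← sq_abs (D x)]
    exact rpow_mul_sq_le hq (abs_nonneg _) (abs_nonneg _)

lemma integrable_abs_rpow_mul_mul {q : ℝ} (hq : 2 < q) {S D : β → ℝ}
    (hS : MemLp S (ENNReal.ofReal q) μ) (hD : MemLp D (ENNReal.ofReal q) μ) :
    Integrable (fun x => |S x| ^ (q - 2) * S x * D x) μ := by
  refine ((integrable_abs_rpow_mul_sq hq hS hS).add
    (integrable_abs_rpow_mul_sq hq hS hD)).mono' ?_ (ae_of_all _ fun x => ?_)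
  · have hSm := hS.1.aemeasurable
    have hDm := hD.1.aemeasurable
    exact AEMeasurable.aestronglyMeasurable (by fun_prop)
  · simp only [Pi.add_apply]
    rw [mul_assoc, norm_mul, Real.norm_of_nonneg (by positivity), ← mul_add, Real.norm_eq_abs,
      abs_mul]
    gcongr
    nlinarith [sq_nonneg (|S x| - |D x|), sq_abs (S x), sq_abs (D x)]

lemma integral_abs_rpow_mul_sq_le {q : ℝ} (hq : 2 < q) {S D : β → ℝ}
    (hS : MemLp S (ENNReal.ofReal q) μ) (hD : MemLp D (ENNReal.ofReal q) μ) :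
    ∫ x, |S x| ^ (q - 2) * D x ^ 2 ∂μ ≤
      (∫ x, |S x| ^ q ∂μ) ^ ((q - 2) / q) * (∫ x, |D x| ^ q ∂μ) ^ (2 / q) := by
  have hq0 : 0 < q := by linarith
  have hq2 : 0 < q - 2 := by linarith
  have hconj : (q / (q - 2)).HolderConjugate (q / 2) := by
    rw [Real.holderConjugate_iff]
    refine ⟨by rw [one_lt_div hq2]; linarith, by field_simp; ring⟩
  have h1 : MemLp (fun x => |S x| ^ (q - 2)) (ENNReal.ofReal (q / (q - 2))) μ := by
    have := hS.norm_rpow_div (ENNReal.ofReal (q - 2))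
    rwa [ENNReal.toReal_ofReal hq2.le, ← ENNReal.ofReal_div_of_pos hq2] at this
  have h2 : MemLp (fun x => D x ^ 2) (ENNReal.ofReal (q / 2)) μ := by
    have := hD.norm_rpow_div (ENNReal.ofReal 2)
    rw [ENNReal.toReal_ofReal (by norm_num), ← ENNReal.ofReal_div_of_pos (by norm_num)] at this
    refine this.congr_norm (hD.1.pow 2) (ae_of_all _ fun x => ?_)
    simp
  have := integral_mul_le_Lp_mul_Lq_of_nonneg hconj (ae_of_all _ fun x => by positivity)
    (ae_of_all _ fun x => by positivity) h1 h2
  refine this.trans_eq ?_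
  have e1 : ∀ x, (|S x| ^ (q - 2)) ^ (q / (q - 2)) = |S x| ^ q := fun x => by
    rw [← Real.rpow_mul (abs_nonneg _)]; congr 1; field_simp
  have e2 : ∀ x, (D x ^ 2) ^ (q / 2) = |D x| ^ q := fun x => by
    rw [← sq_abs, ← Real.rpow_natCast, ← Real.rpow_mul (abs_nonneg _)]
    congr 1; push_cast; field_simp
  simp_rw [e1, e2, one_div_div]

/-- The induction step of Burkholder's inequality. The first-order Taylor term vanishes by `horth`,
Hölder bounds the mixed term by (2cs)^{q/2-1} d, and the factor 2c is chosen so that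
`rpow_add_mul_le` with v = 2cd absorbs both remaining terms and the constant does not grow along the
induction. -/
lemma integral_abs_add_rpow_le {q c : ℝ} (hq : 2 < q)
    (hc : 1 ≤ c ∧ ∀ x y : ℝ, |x + y| ^ q ≤
      |x| ^ q + q * (|x| ^ (q - 2) * x * y) + c * (|x| ^ (q - 2) * y ^ 2 + |y| ^ q))
    {S D : β → ℝ} {s d : ℝ} (hs : 0 ≤ s) (hd : 0 ≤ d)
    (hS : MemLp S (ENNReal.ofReal q) μ) (hD : MemLp D (ENNReal.ofReal q) μ)
    (horth : ∫ x, |S x| ^ (q - 2) * S x * D x ∂μ = 0)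
    (hSs : ∫ x, |S x| ^ q ∂μ ≤ (2 * c * s) ^ (q / 2))
    (hDd : ∫ x, |D x| ^ q ∂μ ≤ d ^ (q / 2)) :
    ∫ x, |S x + D x| ^ q ∂μ ≤ (2 * c * (s + d)) ^ (q / 2) := by
  obtain ⟨hc1, hc⟩ := hc
  have hq0 : 0 < q := by linarith
  have i1 := MemLp.integrable_abs_rpow hq0 hS
  have i2 := MemLp.integrable_abs_rpow hq0 hD
  have i3 := integrable_abs_rpow_mul_mul hq hS hD
  have i4 := integrable_abs_rpow_mul_sq hq hS hD
  have hint : ∫ x, |S x + D x| ^ q ∂μ ≤ ∫ x, |S x| ^ q ∂μ +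
      c * (∫ x, |S x| ^ (q - 2) * D x ^ 2 ∂μ + ∫ x, |D x| ^ q ∂μ) := by
    calc ∫ x, |S x + D x| ^ q ∂μ
        ≤ ∫ x, (|S x| ^ q + q * (|S x| ^ (q - 2) * S x * D x) +
            c * (|S x| ^ (q - 2) * D x ^ 2 + |D x| ^ q)) ∂μ :=
          integral_mono (MemLp.integrable_abs_rpow hq0 (hS.add hD))
            ((i1.add (i3.const_mul q)).add ((i4.add i2).const_mul c)) fun x => hc _ _
      _ = _ := by
          have i5 : Integrable (fun x => |S x| ^ q + q * (|S x| ^ (q - 2) * S x * D x)) μ :=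
            i1.add (i3.const_mul q)
          have i6 : Integrable (fun x => c * (|S x| ^ (q - 2) * D x ^ 2 + |D x| ^ q)) μ :=
            (i4.add i2).const_mul c
          rw [integral_add i5 i6, integral_add i1 (i3.const_mul q), integral_const_mul,
            integral_const_mul, horth, integral_add i4 i2]
          ring
  have hS0 : 0 ≤ ∫ x, |S x| ^ q ∂μ := integral_nonneg fun x => by positivity
  have hD0 : 0 ≤ ∫ x, |D x| ^ q ∂μ := integral_nonneg fun x => by positivity
  have hcs : 0 ≤ 2 * c * s := by positivity
  have h1 : ∫ x, |S x| ^ (q - 2) * D x ^ 2 ∂μ ≤ (2 * c * s) ^ (q / 2 - 1) * d := by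
    refine (integral_abs_rpow_mul_sq_le hq hS hD).trans ?_
    have e1 : (2 * c * s) ^ (q / 2 - 1) = ((2 * c * s) ^ (q / 2)) ^ ((q - 2) / q) := by
      rw [← Real.rpow_mul hcs]; congr 1; field_simp
    have e2 : d = (d ^ (q / 2)) ^ (2 / q) := by
      rw [← Real.rpow_mul hd]
      have : q / 2 * (2 / q) = 1 := by field_simp
      rw [this, Real.rpow_one]
    rw [e1]
    conv_rhs => rw [e2]
    have : 0 ≤ (q - 2) / q := div_nonneg (by linarith) hq0.le
    gcongr
  have h2 := rpow_add_mul_le (p := q / 2) (by linarith) hcs (show 0 ≤ 2 * c * d by positivity)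
  have h3 : 2 * c * d ^ (q / 2) ≤ (2 * c * d) ^ (q / 2) := by
    rw [Real.mul_rpow (by positivity) hd]
    gcongr
    exact Real.self_le_rpow_of_one_le (by linarith) (by linarith)
  rw [mul_add (2 * c)]
  have h4 : 0 ≤ (2 * c * s) ^ (q / 2 - 1) * d := by positivity
  nlinarith

end Moment

section EfronStein

variable {α : Type*} [MeasurableSpace α] {ν : Measure α} [IsProbabilityMeasure ν]

lemma resampleNorm_ne_top {f : (ℕ → α) → ℝ} {q : ℝ}
    (h : MemLp f (ENNReal.ofReal q) (seqLaw ν)) (n : ℕ) : resampleNorm ν q f n ≠ ∞ := by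
  have h1 : MemLp (fun p : (ℕ → α) × (ℕ → α) => f p.1) (ENNReal.ofReal q)
      ((seqLaw ν).prod (seqLaw ν)) := h.comp_measurePreserving measurePreserving_fst
  exact (h1.sub (h.comp_measurePreserving (measurePreserving_resample ν n))).2.ne

lemma integral_abs_rpow_le_of_eLpNorm_le {β : Type*} [MeasurableSpace β] {μ : Measure β}
    {q : ℝ} (hq : 0 < q) {f : β → ℝ} (hf : MemLp f (ENNReal.ofReal q) μ) {a : ℝ} (ha : 0 ≤ a)
    (h : eLpNorm f (ENNReal.ofReal q) μ ≤ ENNReal.ofReal a) :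
    ∫ x, |f x| ^ q ∂μ ≤ a ^ q := by
  rw [hf.eLpNorm_eq_integral_rpow_norm (by simpa using hq) ENNReal.ofReal_ne_top,
    ENNReal.toReal_ofReal hq.le, ENNReal.ofReal_le_ofReal_iff ha] at h
  have h0 : 0 ≤ ∫ x, |f x| ^ q ∂μ := integral_nonneg fun x => by positivity
  have := Real.rpow_le_rpow (by positivity) h hq.le
  simp only [Real.norm_eq_abs] at this
  rwa [← Real.rpow_mul h0, inv_mul_cancel₀ hq.ne', Real.rpow_one] at this

lemma eLpNorm_sq_le_of_integral_abs_rpow_le {β : Type*} [MeasurableSpace β] {μ : Measure β}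
    {q : ℝ} (hq : 0 < q) {f : β → ℝ} (hf : MemLp f (ENNReal.ofReal q) μ) {a : ℝ} (ha : 0 ≤ a)
    (h : ∫ x, |f x| ^ q ∂μ ≤ a ^ (q / 2)) :
    eLpNorm f (ENNReal.ofReal q) μ ^ 2 ≤ ENNReal.ofReal a := by
  have h0 : 0 ≤ ∫ x, |f x| ^ q ∂μ := integral_nonneg fun x => by positivity
  rw [hf.eLpNorm_eq_integral_rpow_norm (by simpa using hq) ENNReal.ofReal_ne_top,
    ENNReal.toReal_ofReal hq.le, ← ENNReal.ofReal_pow (by positivity)]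
  refine ENNReal.ofReal_le_ofReal ?_
  simp only [Real.norm_eq_abs]
  calc ((∫ x, |f x| ^ q ∂μ) ^ q⁻¹) ^ 2 ≤ ((a ^ (q / 2)) ^ q⁻¹) ^ 2 := by gcongr
    _ = a := by
      rw [← Real.rpow_mul ha, ← Real.rpow_natCast, ← Real.rpow_mul ha]
      have : q / 2 * q⁻¹ * (2 : ℕ) = 1 := by push_cast; field_simp
      rw [this, Real.rpow_one]

lemma MemLp.integrable_of_one_le {β : Type*} [MeasurableSpace β] {μ : Measure β}
    [IsFiniteMeasure μ] {q : ℝ} (hq : 1 ≤ q) {f : β → ℝ}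
    (hf : MemLp f (ENNReal.ofReal q) μ) : Integrable f μ :=
  hf.integrable (by simpa using hq)

/-- Burkholder's inequality for the martingale of tail averages. -/
lemma exists_integral_tailAverage_sub_rpow_le {q : ℝ} (hq : 2 < q) :
    ∃ B : ℝ, 0 < B ∧ ∀ {α : Type*} [MeasurableSpace α] (ν : Measure α) [IsProbabilityMeasure ν]
      (f : (ℕ → α) → ℝ), Measurable f → MemLp f (ENNReal.ofReal q) (seqLaw ν) → ∀ N k : ℕ,
      ∫ x, |tailAverage ν (N + k) f x - tailAverage ν N f x| ^ q ∂(seqLaw ν) ≤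
        (B * ∑ i ∈ Finset.range k, (resampleNorm ν q f (N + i)).toReal ^ 2) ^ (q / 2) := by
  obtain ⟨c, hc⟩ := exists_abs_add_rpow_le hq
  have hq1 : 1 ≤ q := by linarith
  refine ⟨2 * c, by linarith [hc.1], fun {α} _ ν _ f hf hLp N k => ?_⟩
  have hA : ∀ n, MemLp (tailAverage ν n f) (ENNReal.ofReal q) (seqLaw ν) := fun n =>
    memLp_tailAverage hf n hq1 hLp
  induction k with
  | zero => simp [Real.zero_rpow (show q ≠ 0 by linarith),
      Real.zero_rpow (show q / 2 ≠ 0 by linarith)]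
  | succ k ih =>
    rw [Finset.sum_range_succ]
    have hS := (hA (N + k)).sub (hA N)
    have hD := (hA (N + (k + 1))).sub (hA (N + k))
    have e : ∀ x, tailAverage ν (N + (k + 1)) f x - tailAverage ν N f x =
        (tailAverage ν (N + k) f - tailAverage ν N f) x +
        (tailAverage ν (N + (k + 1)) f - tailAverage ν (N + k) f) x := fun x => by
      simp
    simp_rw [e]
    refine integral_abs_add_rpow_le hq hc (Finset.sum_nonneg fun i _ => by positivity)
      (by positivity) hS hD ?_ ih ?_
    -- Orthogonality: |S|^{q-2} S depends on the first `N + k` coordinates only, so both consecutive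
    -- tail averages integrate against it exactly as `f` does.
    · set S := tailAverage ν (N + k) f - tailAverage ν N f with hSdef
      have hdep : DependsOnFirst (N + k) (fun x => |S x| ^ (q - 2) * S x) := fun x y => by
        have h1 := dependsOnFirst_tailAverage (ν := ν) (N + k) f x y
        have h2 := (dependsOnFirst_tailAverage (ν := ν) N f).mono (Nat.le_add_right N k) x y
        simp only [hSdef, Pi.sub_apply, h1, h2]
      have hSm : Measurable S := (measurable_tailAverage hf _).sub (measurable_tailAverage hf _)
      have hφm : Measurable (fun x => |S x| ^ (q - 2) * S x) := by fun_prop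
      have hfφ : Integrable (fun x => f x * (|S x| ^ (q - 2) * S x)) (seqLaw ν) := by
        have := integrable_abs_rpow_mul_mul hq hS hLp
        refine this.congr (ae_of_all _ fun x => ?_)
        simp only; ring
      have h1 := integral_tailAverage_mul hdep hf hφm hfφ
      have h2 := integral_tailAverage_mul (hdep.mono (Nat.le_succ _)) hf hφm hfφ
      have h3 := integral_sub h2.1 h1.1
      rw [h2.2, h1.2, sub_self] at h3
      rw [← h3]
      refine integral_congr_ae (ae_of_all _ fun x => ?_)
      simp only [Pi.sub_apply, ← Nat.add_assoc]; ring
    · have h1 := eLpNorm_tailAverage_succ_sub_le hf (MemLp.integrable_of_one_le hq1 hLp)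
        (N + k) hq1
      have h2 := integral_abs_rpow_le_of_eLpNorm_le (by linarith) hD
        (a := (resampleNorm ν q f (N + k)).toReal) ENNReal.toReal_nonneg (by
          rw [ENNReal.ofReal_toReal (resampleNorm_ne_top hLp _)]
          exact h1)
      refine h2.trans_eq ?_
      rw [← Real.rpow_natCast, ← Real.rpow_mul ENNReal.toReal_nonneg]
      congr 1; push_cast; ring

/-- A moment version of the Efron-Stein inequality. -/
theorem exists_eLpNorm_sub_tailAverage_sq_le {q : ℝ} (hq : 2 < q) :
    ∃ B : ℝ, 0 < B ∧ ∀ {α : Type*} [MeasurableSpace α] (ν : Measure α) [IsProbabilityMeasure ν]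
      (f : (ℕ → α) → ℝ), Measurable f → MemLp f (ENNReal.ofReal q) (seqLaw ν) → ∀ N : ℕ,
      eLpNorm (fun x => f x - tailAverage ν N f x) (ENNReal.ofReal q) (seqLaw ν) ^ 2 ≤
        ENNReal.ofReal B * ∑' i, resampleNorm ν q f (N + i) ^ 2 := by
  obtain ⟨B, hB, h⟩ := exists_integral_tailAverage_sub_rpow_le.{_} hq
  refine ⟨B, hB, fun {α} _ ν _ f hf hLp N => ?_⟩
  have hq1 : 1 ≤ q := by linarith
  have hA : ∀ n, MemLp (tailAverage ν n f) (ENNReal.ofReal q) (seqLaw ν) := fun n =>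
    memLp_tailAverage hf n hq1 hLp
  have hb : ∀ k, eLpNorm (fun x => tailAverage ν (N + k) f x - tailAverage ν N f x)
      (ENNReal.ofReal q) (seqLaw ν) ≤
      (ENNReal.ofReal B * ∑' i, resampleNorm ν q f (N + i) ^ 2) ^ (1 / 2 : ℝ) := fun k => by
    have h1 := eLpNorm_sq_le_of_integral_abs_rpow_le (by linarith)
      ((hA (N + k)).sub (hA N)) (by positivity) (h ν f hf hLp N k)
    rw [ENNReal.ofReal_mul hB.le, ENNReal.ofReal_sum_of_nonneg fun i _ => by positivity] at h1
    have h2 : ∀ i ∈ Finset.range k, ENNReal.ofReal ((resampleNorm ν q f (N + i)).toReal ^ 2) =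
        resampleNorm ν q f (N + i) ^ 2 := fun i _ => by
      rw [ENNReal.ofReal_pow ENNReal.toReal_nonneg,
        ENNReal.ofReal_toReal (resampleNorm_ne_top hLp _)]
    rw [Finset.sum_congr rfl h2] at h1
    have h3 := h1.trans (mul_le_mul_right (ENNReal.sum_le_tsum (f := fun i =>
      resampleNorm ν q f (N + i) ^ 2) (Finset.range k)) _)
    rw [one_div, ENNReal.le_rpow_inv_iff (by norm_num)]
    exact_mod_cast h3
  -- The bound on finite stretches of the martingale passes to the limit by Fatou's lemma and almost
  -- sure convergence.
  have hlim : eLpNorm (fun x => f x - tailAverage ν N f x) (ENNReal.ofReal q) (seqLaw ν) ≤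
      (ENNReal.ofReal B * ∑' i, resampleNorm ν q f (N + i) ^ 2) ^ (1 / 2 : ℝ) := by
    refine Lp.eLpNorm_le_of_ae_tendsto (u := atTop) (Eventually.of_forall hb)
      (fun k => ((hA (N + k)).sub (hA N)).1) ?_
    filter_upwards [tendsto_tailAverage hf (MemLp.integrable_of_one_le hq1 hLp)] with x hx
    refine Tendsto.sub_const ?_ _
    have := (tendsto_add_atTop_iff_nat N).2 hx
    simpa only [Nat.add_comm N] using this
  rw [one_div, ENNReal.le_rpow_inv_iff (by norm_num)] at hlim
  exact_mod_cast hlim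

end EfronStein

end LagWindow

/-! ### Covariances bounded through resampling norms. -/

namespace LagWindow

/-- Cauchy-Schwarz in `L^q`. -/
lemma eLpNorm_mul_le_two_mul {β : Type*} [MeasurableSpace β] {μ : Measure β} {q : ℝ} (hq : 0 < q)
    {f g : β → ℝ} (hf : Measurable f) (hg : Measurable g) :
    eLpNorm (fun x => f x * g x) (ENNReal.ofReal q) μ ≤
      eLpNorm f (ENNReal.ofReal (2 * q)) μ * eLpNorm g (ENNReal.ofReal (2 * q)) μ := by
  have : ENNReal.HolderTriple (ENNReal.ofReal (2 * q)) (ENNReal.ofReal (2 * q))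
      (ENNReal.ofReal q) := ⟨by
    rw [← ENNReal.ofReal_inv_of_pos (by positivity), ← ENNReal.ofReal_inv_of_pos hq,
      ← ENNReal.ofReal_add (by positivity) (by positivity)]
    congr 1
    field_simp
    norm_num⟩
  exact eLpNorm_smul_le_mul_eLpNorm (p := ENNReal.ofReal (2 * q)) (q := ENNReal.ofReal (2 * q))
    (r := ENNReal.ofReal q) (f := g) (φ := f) hg.aestronglyMeasurable hf.aestronglyMeasurable

lemma enorm_integral_mul_le {β : Type*} [MeasurableSpace β] {μ : Measure β}
    {f g : β → ℝ} (hf : Measurable f) (hg : Measurable g) :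
    ‖∫ x, f x * g x ∂μ‖ₑ ≤
      eLpNorm f (ENNReal.ofReal 2) μ * eLpNorm g (ENNReal.ofReal 2) μ := by
  refine (enorm_integral_le_lintegral_enorm _).trans ?_
  have := eLpNorm_mul_le_two_mul (μ := μ) one_pos hf hg
  rwa [ENNReal.ofReal_one, eLpNorm_one_eq_lintegral_enorm, mul_one] at this

section Covariance

variable {α : Type*} [MeasurableSpace α] {ν : Measure α} [IsProbabilityMeasure ν]

lemma MemLp.integrable_mul_of_two {β : Type*} [MeasurableSpace β] {μ : Measure β} {f g : β → ℝ}
    (hf : MemLp f (ENNReal.ofReal 2) μ) (hg : MemLp g (ENNReal.ofReal 2) μ) :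
    Integrable (fun x => f x * g x) μ := by
  rw [ENNReal.ofReal_ofNat] at hf hg
  exact hf.integrable_mul hg

/-- Each martingale increment is orthogonal to the past of the other martingale. Hence the integral
of the product grows by the integral of the product of the increments, to which Cauchy-Schwarz
applies. -/
lemma integral_tailAverage_mul_tailAverage_succ_sub {f g : (ℕ → α) → ℝ} (hf : Measurable f)
    (hg : Measurable g) (hf2 : MemLp f (ENNReal.ofReal 2) (seqLaw ν))
    (hg2 : MemLp g (ENNReal.ofReal 2) (seqLaw ν)) (n : ℕ) :
    ‖∫ x, tailAverage ν (n + 1) f x * tailAverage ν (n + 1) g x ∂(seqLaw ν) -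
      ∫ x, tailAverage ν n f x * tailAverage ν n g x ∂(seqLaw ν)‖ₑ ≤
      resampleNorm ν 2 f n * resampleNorm ν 2 g n := by
  have hA : ∀ {h : (ℕ → α) → ℝ}, Measurable h → MemLp h (ENNReal.ofReal 2) (seqLaw ν) → ∀ n,
      MemLp (tailAverage ν n h) (ENNReal.ofReal 2) (seqLaw ν) := fun hm h2 n =>
    memLp_tailAverage hm n one_le_two h2
  have cross : ∀ {h k : (ℕ → α) → ℝ}, Measurable h → MemLp h (ENNReal.ofReal 2) (seqLaw ν) →
      Measurable k → MemLp k (ENNReal.ofReal 2) (seqLaw ν) →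
      ∫ x, tailAverage ν (n + 1) h x * tailAverage ν n k x ∂(seqLaw ν) =
        ∫ x, tailAverage ν n h x * tailAverage ν n k x ∂(seqLaw ν) := by
    intro h k hm h2 km k2
    have hi := MemLp.integrable_mul_of_two h2 (hA km k2 n)
    have hd := dependsOnFirst_tailAverage (ν := ν) n k
    rw [(integral_tailAverage_mul hd hm (measurable_tailAverage km n) hi).2,
      (integral_tailAverage_mul (hd.mono (Nat.le_succ n)) hm (measurable_tailAverage km n) hi).2]
  have e : ∫ x, tailAverage ν (n + 1) f x * tailAverage ν (n + 1) g x ∂(seqLaw ν) -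
      ∫ x, tailAverage ν n f x * tailAverage ν n g x ∂(seqLaw ν) =
      ∫ x, (tailAverage ν (n + 1) f x - tailAverage ν n f x) *
        (tailAverage ν (n + 1) g x - tailAverage ν n g x) ∂(seqLaw ν) := by
    have c1 := cross hf hf2 hg hg2
    have c2 := cross hg hg2 hf hf2
    simp_rw [mul_comm _ (tailAverage ν n f _)] at c2
    have i := fun a b => MemLp.integrable_mul_of_two (hA hf hf2 a) (hA hg hg2 b)
    have e1 : ∀ x, (tailAverage ν (n + 1) f x - tailAverage ν n f x) *
        (tailAverage ν (n + 1) g x - tailAverage ν n g x) =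
        (tailAverage ν (n + 1) f x * tailAverage ν (n + 1) g x -
          tailAverage ν (n + 1) f x * tailAverage ν n g x) -
        (tailAverage ν n f x * tailAverage ν (n + 1) g x -
          tailAverage ν n f x * tailAverage ν n g x) := fun x => by ring
    have i' : ∀ a b b', Integrable (fun x => tailAverage ν a f x * tailAverage ν b g x -
        tailAverage ν a f x * tailAverage ν b' g x) (seqLaw ν) := fun a b b' => (i _ _).sub (i _ _)
    simp_rw [e1]
    rw [integral_sub (i' _ _ _) (i' _ _ _), integral_sub (i _ _) (i _ _),
      integral_sub (i _ _) (i _ _), c1, c2]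
    ring
  rw [e]
  refine (enorm_integral_mul_le ((measurable_tailAverage hf _).sub (measurable_tailAverage hf _))
    ((measurable_tailAverage hg _).sub (measurable_tailAverage hg _))).trans ?_
  exact mul_le_mul'
    (eLpNorm_tailAverage_succ_sub_le hf (MemLp.integrable_of_one_le one_le_two hf2) n one_le_two)
    (eLpNorm_tailAverage_succ_sub_le hg (MemLp.integrable_of_one_le one_le_two hg2) n one_le_two)

lemma tendsto_tsum_add_zero {a : ℕ → ℝ≥0∞} (ha : ∑' i, a i ≠ ∞) :
    Tendsto (fun n => ∑' i, a (n + i)) atTop (nhds 0) := by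
  have := ENNReal.tendsto_sum_nat_add a ha
  simpa only [Nat.add_comm] using this

/-- A covariance is bounded by the sum of the products of the resampling norms. -/
theorem enorm_integral_mul_sub_le {f g : (ℕ → α) → ℝ} (hf : Measurable f)
    (hg : Measurable g) (hf4 : MemLp f (ENNReal.ofReal 4) (seqLaw ν))
    (hg4 : MemLp g (ENNReal.ofReal 4) (seqLaw ν))
    (hfin : ∑' i, resampleNorm ν 4 f i ^ 2 ≠ ∞) :
    ‖∫ x, f x * g x ∂(seqLaw ν) - (∫ x, f x ∂(seqLaw ν)) * ∫ x, g x ∂(seqLaw ν)‖ₑ ≤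
      ∑' i, resampleNorm ν 2 f i * resampleNorm ν 2 g i := by
  have h24 : ENNReal.ofReal 2 ≤ ENNReal.ofReal 4 := ENNReal.ofReal_le_ofReal (by norm_num)
  have hf2 := hf4.mono_exponent h24
  have hg2 := hg4.mono_exponent h24
  -- The Efron-Stein bound requires an exponent strictly above 2. It is used only to show that the
  -- remainder `hrest` of the telescoping sum tends to zero, so 4 will do.
  obtain ⟨B, hB, hES⟩ := exists_eLpNorm_sub_tailAverage_sq_le.{_} (q := 4) (by norm_num)
  set c : ℕ → ℝ := fun n =>
    ∫ x, tailAverage ν n f x * tailAverage ν n g x ∂(seqLaw ν) with hc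
  have hc0 : c 0 = (∫ x, f x ∂(seqLaw ν)) * ∫ x, g x ∂(seqLaw ν) := by
    simp only [hc, tailAverage_zero, integral_const, probReal_univ, one_smul]
  have hstep : ∀ n, ‖c n - c 0‖ₑ ≤ ∑ i ∈ Finset.range n,
      resampleNorm ν 2 f i * resampleNorm ν 2 g i := by
    intro n
    induction n with
    | zero => simp
    | succ n ih =>
      rw [Finset.sum_range_succ]
      have : c (n + 1) - c 0 = (c n - c 0) + (c (n + 1) - c n) := by ring
      rw [this]
      exact (enorm_add_le _ _).trans (add_le_add ih
        (integral_tailAverage_mul_tailAverage_succ_sub hf hg hf2 hg2 n))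
  have hrest : ∀ n, ‖∫ x, f x * g x ∂(seqLaw ν) - c n‖ₑ ≤
      (ENNReal.ofReal B * ∑' i, resampleNorm ν 4 f (n + i) ^ 2) ^ (1 / 2 : ℝ) *
        eLpNorm g (ENNReal.ofReal 2) (seqLaw ν) := by
    intro n
    have hAf := memLp_tailAverage hf n one_le_two hf2
    have hi := MemLp.integrable_mul_of_two hg2 hAf
    have h1 := (integral_tailAverage_mul (dependsOnFirst_tailAverage (ν := ν) n f) hg
      (measurable_tailAverage hf n) hi).2
    have h2 : ∫ x, f x * g x ∂(seqLaw ν) - c n =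
        ∫ x, (f x - tailAverage ν n f x) * g x ∂(seqLaw ν) := by
      simp_rw [sub_mul]
      rw [integral_sub (MemLp.integrable_mul_of_two hf2 hg2)
        (MemLp.integrable_mul_of_two hAf hg2), hc]
      simp_rw [mul_comm (tailAverage ν n f _)]
      rw [h1]
    rw [h2]
    refine (enorm_integral_mul_le (hf.sub (measurable_tailAverage hf n)) hg).trans ?_
    gcongr
    refine (eLpNorm_le_eLpNorm_of_exponent_le h24
      (hf.sub (measurable_tailAverage hf n)).aestronglyMeasurable).trans ?_
    rw [one_div, ENNReal.le_rpow_inv_iff (by norm_num)]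
    exact_mod_cast hES ν f hf hf4 n
  have hlim : Tendsto (fun n => (ENNReal.ofReal B * ∑' i, resampleNorm ν 4 f (n + i) ^ 2) ^
      (1 / 2 : ℝ) * eLpNorm g (ENNReal.ofReal 2) (seqLaw ν) +
      ∑' i, resampleNorm ν 2 f i * resampleNorm ν 2 g i) atTop
      (nhds (∑' i, resampleNorm ν 2 f i * resampleNorm ν 2 g i)) := by
    have h1 := ENNReal.Tendsto.const_mul (a := ENNReal.ofReal B) (tendsto_tsum_add_zero hfin)
      (Or.inr ENNReal.ofReal_ne_top)
    have h2 := (h1.ennrpow_const (1 / 2 : ℝ))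
    have h3 := ENNReal.Tendsto.mul_const h2 (b := eLpNorm g (ENNReal.ofReal 2) (seqLaw ν))
      (Or.inr hg2.2.ne)
    have h4 := h3.add_const (∑' i, resampleNorm ν 2 f i * resampleNorm ν 2 g i)
    simpa using h4
  refine ge_of_tendsto' hlim fun n => ?_
  rw [← hc0]
  have : ∫ x, f x * g x ∂(seqLaw ν) - c 0 =
      (∫ x, f x * g x ∂(seqLaw ν) - c n) + (c n - c 0) := by ring
  rw [this]
  exact (enorm_add_le _ _).trans (add_le_add (hrest n)
    ((hstep n).trans (ENNReal.sum_le_tsum _)))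

end Covariance

end LagWindow

/-! ### Calculus of functions with controlled resampling norms. -/

namespace LagWindow

set_option linter.unusedSectionVars false

section Controlled

variable {α : Type*} [MeasurableSpace α] {ν : Measure α} [IsProbabilityMeasure ν]

/-- Product rule: fg - f'g' = (f - f')g + f'(g - g'), where f' has the law of f. Cauchy-Schwarz
doubles the exponent. -/
lemma resampleNorm_mul_le {f g : (ℕ → α) → ℝ} (hf : Measurable f) (hg : Measurable g) {q : ℝ}
    (hq : 1 ≤ q) (n : ℕ) :
    resampleNorm ν q (fun x => f x * g x) n ≤
      resampleNorm ν (2 * q) f n * eLpNorm g (ENNReal.ofReal (2 * q)) (seqLaw ν) +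
      eLpNorm f (ENNReal.ofReal (2 * q)) (seqLaw ν) * resampleNorm ν (2 * q) g n := by
  have hr := measurePreserving_resample ν n
  have hf' : Measurable (fun p : (ℕ → α) × (ℕ → α) => f (Function.update p.1 n (p.2 n))) :=
    hf.comp hr.measurable
  have hg' : Measurable (fun p : (ℕ → α) × (ℕ → α) => g (Function.update p.1 n (p.2 n))) :=
    hg.comp hr.measurable
  have e : (fun p : (ℕ → α) × (ℕ → α) => f p.1 * g p.1 -
      f (Function.update p.1 n (p.2 n)) * g (Function.update p.1 n (p.2 n))) =
      (fun p => (f p.1 - f (Function.update p.1 n (p.2 n))) * g p.1) +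
      fun p => f (Function.update p.1 n (p.2 n)) *
        (g p.1 - g (Function.update p.1 n (p.2 n))) := by
    funext p; simp only [Pi.add_apply]; ring
  have h1 : eLpNorm (fun p : (ℕ → α) × (ℕ → α) => g p.1) (ENNReal.ofReal (2 * q))
      ((seqLaw ν).prod (seqLaw ν)) = eLpNorm g (ENNReal.ofReal (2 * q)) (seqLaw ν) :=
    eLpNorm_comp_measurePreserving hg.aestronglyMeasurable measurePreserving_fst
  have h2 : eLpNorm (fun p : (ℕ → α) × (ℕ → α) => f (Function.update p.1 n (p.2 n)))
      (ENNReal.ofReal (2 * q)) ((seqLaw ν).prod (seqLaw ν)) =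
      eLpNorm f (ENNReal.ofReal (2 * q)) (seqLaw ν) :=
    eLpNorm_comp_measurePreserving hf.aestronglyMeasurable hr
  rw [resampleNorm, e]
  refine (eLpNorm_add_le (Measurable.aestronglyMeasurable (by fun_prop))
    (Measurable.aestronglyMeasurable (by fun_prop)) (by simpa using hq)).trans
    (add_le_add ?_ ?_)
  · rw [← h1]
    exact eLpNorm_mul_le_two_mul (by linarith) (by fun_prop) (by fun_prop)
  · rw [← h2]
    exact eLpNorm_mul_le_two_mul (by linarith) (by fun_prop) (by fun_prop)

variable (ν) in
/-- `f` is measurable, has `L^q` norm at most `A` and resampling norms at most `a`. -/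
structure Controlled (q : ℝ) (f : (ℕ → α) → ℝ) (A : ℝ≥0∞) (a : ℕ → ℝ≥0∞) : Prop where
  measurable : Measurable f
  norm_le : eLpNorm f (ENNReal.ofReal q) (seqLaw ν) ≤ A
  resample_le : ∀ n, resampleNorm ν q f n ≤ a n

namespace Controlled

variable {q : ℝ} {f g : (ℕ → α) → ℝ} {A B : ℝ≥0∞} {a b : ℕ → ℝ≥0∞}

lemma memLp (h : Controlled ν q f A a) (hA : A ≠ ∞) : MemLp f (ENNReal.ofReal q) (seqLaw ν) :=
  ⟨h.measurable.aestronglyMeasurable, h.norm_le.trans_lt hA.lt_top⟩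

lemma mono (h : Controlled ν q f A a) (hA : A ≤ B) (ha : ∀ n, a n ≤ b n) :
    Controlled ν q f B b :=
  ⟨h.measurable, h.norm_le.trans hA, fun n => (h.resample_le n).trans (ha n)⟩

lemma mono_exponent (h : Controlled ν q f A a) {q' : ℝ} (hq : q' ≤ q) :
    Controlled ν q' f A a := by
  have hm : Measurable (fun p : (ℕ → α) × (ℕ → α) => f p.1) := h.measurable.comp measurable_fst
  refine ⟨h.measurable, (eLpNorm_le_eLpNorm_of_exponent_le (ENNReal.ofReal_le_ofReal hq)
    h.measurable.aestronglyMeasurable).trans h.norm_le, fun n =>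
    (eLpNorm_le_eLpNorm_of_exponent_le (ENNReal.ofReal_le_ofReal hq) ?_).trans
      (h.resample_le n)⟩
  exact (hm.sub (h.measurable.comp
    (measurePreserving_resample ν n).measurable)).aestronglyMeasurable

lemma mul (hq : 1 ≤ q) (hf : Controlled ν (2 * q) f A a) (hg : Controlled ν (2 * q) g B b) :
    Controlled ν q (fun x => f x * g x) (A * B) (fun n => a n * B + A * b n) := by
  refine ⟨hf.measurable.mul hg.measurable,
    (eLpNorm_mul_le_two_mul (by linarith) hf.measurable hg.measurable).trans
      (mul_le_mul' hf.norm_le hg.norm_le), fun n =>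
    (resampleNorm_mul_le hf.measurable hg.measurable hq n).trans (add_le_add
      (mul_le_mul' (hf.resample_le n) hg.norm_le) (mul_le_mul' hf.norm_le (hg.resample_le n)))⟩

lemma sub_const (hq : 1 ≤ q) (hf : Controlled ν q f A a) (c : ℝ) :
    Controlled ν q (fun x => f x - c) (A + ‖c‖ₑ) a := by
  refine ⟨hf.measurable.sub_const c, ?_, fun n => ?_⟩
  · refine (eLpNorm_sub_le hf.measurable.aestronglyMeasurable aestronglyMeasurable_const
      (by simpa using hq)).trans (add_le_add hf.norm_le ?_)
    rw [eLpNorm_const _ (by simpa using hq.trans_lt' one_pos) (NeZero.ne _)]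
    simp
  · have := hf.resample_le n
    simpa [resampleNorm] using this

lemma const_mul (hf : Controlled ν q f A a) (c : ℝ) :
    Controlled ν q (fun x => c * f x) (‖c‖ₑ * A) (fun n => ‖c‖ₑ * a n) := by
  refine ⟨hf.measurable.const_mul c, ?_, fun n => ?_⟩
  · refine (eLpNorm_const_smul c f _ _).le.trans ?_
    gcongr
    exact hf.norm_le
  · have e : (fun p : (ℕ → α) × (ℕ → α) => c * f p.1 - c * f (Function.update p.1 n (p.2 n))) =
        c • (fun p => f p.1 - f (Function.update p.1 n (p.2 n))) := by
      funext p; simp only [Pi.smul_apply, smul_eq_mul]; ring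
    rw [resampleNorm, e]
    refine (eLpNorm_const_smul c _ _ _).le.trans ?_
    gcongr
    exact hf.resample_le n

lemma add (hq : 1 ≤ q) (hf : Controlled ν q f A a) (hg : Controlled ν q g B b) :
    Controlled ν q (fun x => f x + g x) (A + B) (fun n => a n + b n) := by
  refine ⟨hf.measurable.add hg.measurable, (eLpNorm_add_le hf.measurable.aestronglyMeasurable
    hg.measurable.aestronglyMeasurable (by simpa using hq)).trans
    (add_le_add hf.norm_le hg.norm_le), fun n => ?_⟩
  have hr := (measurePreserving_resample ν n).measurable
  have e : (fun p : (ℕ → α) × (ℕ → α) => f p.1 + g p.1 -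
      (f (Function.update p.1 n (p.2 n)) + g (Function.update p.1 n (p.2 n)))) =
      (fun p => (f p.1 - f (Function.update p.1 n (p.2 n)))) +
      fun p => (g p.1 - g (Function.update p.1 n (p.2 n))) := by
    funext p; simp only [Pi.add_apply]; ring
  rw [resampleNorm, e]
  exact (eLpNorm_add_le
    ((hf.measurable.comp measurable_fst).sub (hf.measurable.comp hr)).aestronglyMeasurable
    ((hg.measurable.comp measurable_fst).sub (hg.measurable.comp hr)).aestronglyMeasurable
    (by simpa using hq)).trans (add_le_add (hf.resample_le n) (hg.resample_le n))

lemma zero : Controlled ν q (fun _ => 0) 0 (fun _ => 0) :=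
  ⟨measurable_const, by simp, fun n => by simp [resampleNorm]⟩

lemma sum (hq : 1 ≤ q) {ι : Type*} (s : Finset ι) {F : ι → (ℕ → α) → ℝ} {C : ι → ℝ≥0∞}
    {c : ι → ℕ → ℝ≥0∞} (h : ∀ i ∈ s, Controlled ν q (F i) (C i) (c i)) :
    Controlled ν q (fun x => ∑ i ∈ s, F i x) (∑ i ∈ s, C i) (fun n => ∑ i ∈ s, c i n) := by
  classical
  induction s using Finset.induction_on with
  | empty => simpa using zero
  | insert i s hi ih =>
    simp only [Finset.sum_insert hi]
    exact (h i (Finset.mem_insert_self i s)).add hq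
      (ih fun j hj => h j (Finset.mem_insert_of_mem hj))

lemma enorm_integral_le (hq : 1 ≤ q) (hf : Controlled ν q f A a) :
    ‖∫ x, f x ∂(seqLaw ν)‖ₑ ≤ A := by
  refine (enorm_integral_le_lintegral_enorm _).trans ?_
  rw [← eLpNorm_one_eq_lintegral_enorm]
  exact (eLpNorm_le_eLpNorm_of_exponent_le (by simpa using hq)
    hf.measurable.aestronglyMeasurable).trans hf.norm_le

/-- The covariance bound for controlled functions. -/
lemma enorm_covariance_le (hq : 4 ≤ q) (hf : Controlled ν q f A a) (hg : Controlled ν q g B b)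
    (hA : A ≠ ∞) (hB : B ≠ ∞) (hfin : ∑' n, a n ^ 2 ≠ ∞) :
    ‖∫ x, f x * g x ∂(seqLaw ν) - (∫ x, f x ∂(seqLaw ν)) * ∫ x, g x ∂(seqLaw ν)‖ₑ ≤
      ∑' n, a n * b n := by
  have hf4 := hf.mono_exponent hq
  have hg4 := hg.mono_exponent hq
  refine (enorm_integral_mul_sub_le hf.measurable hg.measurable (hf4.memLp hA) (hg4.memLp hB)
    ?_).trans ?_
  · exact ne_top_of_le_ne_top hfin (ENNReal.tsum_le_tsum fun n => by
      gcongr; exact hf4.resample_le n)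
  · exact ENNReal.tsum_le_tsum fun n => mul_le_mul'
      ((hf.mono_exponent (by linarith)).resample_le n)
      ((hg.mono_exponent (by linarith)).resample_le n)

end Controlled

/-- A concentration inequality in `L^q` for controlled functions. -/
lemma exists_eLpNorm_sub_integral_le {q : ℝ} (hq : 2 < q) :
    ∃ D : ℝ≥0∞, D ≠ ∞ ∧ ∀ {α : Type*} [MeasurableSpace α] (ν : Measure α)
      [IsProbabilityMeasure ν] (f : (ℕ → α) → ℝ) (A : ℝ≥0∞) (a : ℕ → ℝ≥0∞),
      Controlled ν q f A a → A ≠ ∞ → ∀ (U τ : ℝ≥0∞), (∀ n, a n ≤ U) → ∑' n, a n ≤ τ ^ 2 * U →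
      eLpNorm (fun x => f x - ∫ y, f y ∂(seqLaw ν)) (ENNReal.ofReal q) (seqLaw ν) ≤
        D * (U * τ) := by
  obtain ⟨B, -, h⟩ := exists_eLpNorm_sub_tailAverage_sq_le.{_} hq
  refine ⟨ENNReal.ofReal B ^ (1 / 2 : ℝ), by finiteness, fun {α} _ ν _ f A a hf hA U τ hU hV => ?_⟩
  have h1 := h ν f hf.measurable (hf.memLp hA) 0
  simp only [tailAverage_zero, zero_add] at h1
  -- The sum of squares is at most the supremum times the sum. In the applications τ is √T.
  have h2 : ∑' i, resampleNorm ν q f i ^ 2 ≤ (U * τ) ^ 2 := by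
    calc ∑' i, resampleNorm ν q f i ^ 2 ≤ ∑' i, U * a i :=
          ENNReal.tsum_le_tsum fun i => by
            rw [sq]
            exact mul_le_mul' ((hf.resample_le i).trans (hU i)) (hf.resample_le i)
      _ = U * ∑' i, a i := ENNReal.tsum_mul_left
      _ ≤ U * (τ ^ 2 * U) := by gcongr
      _ = (U * τ) ^ 2 := by ring
  have h3 := h1.trans (mul_le_mul_right h2 _)
  rw [← ENNReal.pow_le_pow_left_iff two_ne_zero, mul_pow, ← ENNReal.rpow_mul_natCast]
  simpa using h3

end Controlled

section Coefficients

variable {θ : ℤ → ℝ≥0∞}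

lemma tsum_shift_le (θ : ℤ → ℝ≥0∞) (u : ℤ) : ∑' n : ℕ, θ (u + n) ≤ ∑' k, θ k :=
  ENNReal.tsum_comp_le_tsum_of_injective (f := fun n : ℕ => u + (n : ℤ))
    (fun a b h => by simpa using h) θ

lemma sum_shift_le (θ : ℤ → ℝ≥0∞) (s : Finset ℕ) (u : ℤ) :
    ∑ t ∈ s, θ ((t : ℤ) + u) ≤ ∑' k, θ k :=
  (ENNReal.sum_le_tsum s).trans (ENNReal.tsum_comp_le_tsum_of_injective
    (f := fun n : ℕ => (n : ℤ) + u) (fun a b h => by simpa using h) θ)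

/-- `θ` vanishes on the negative integers and is nonincreasing on the nonnegative ones. -/
structure Decay (θ : ℤ → ℝ≥0∞) : Prop where
  neg : ∀ k < 0, θ k = 0
  anti : ∀ k l, 0 ≤ k → k ≤ l → θ l ≤ θ k

/-- Wherever the factor with the smaller argument is nonzero, that argument is nonnegative, so the
other argument is at least `d` and monotonicity applies. -/
lemma Decay.tsum_mul_le (hθ : Decay θ) {u v d : ℤ} (hd : 0 ≤ d) (h : d ≤ |u - v|) :
    ∑' n : ℕ, θ (u + n) * θ (v + n) ≤ (∑' k, θ k) * θ d := by
  wlog huv : u ≤ v generalizing u v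
  · simp_rw [mul_comm (θ (u + _))]
    exact this (by rwa [abs_sub_comm]) (le_of_not_ge huv)
  rw [abs_sub_comm, abs_of_nonneg (sub_nonneg.2 huv)] at h
  calc ∑' n : ℕ, θ (u + n) * θ (v + n) ≤ ∑' n : ℕ, θ (u + n) * θ d :=
        ENNReal.tsum_le_tsum fun n => by
          rcases lt_or_ge (u + n) 0 with hn | hn
          · simp [hθ.neg _ hn]
          · gcongr
            exact hθ.anti _ _ hd (by linarith)
    _ = (∑' n : ℕ, θ (u + n)) * θ d := ENNReal.tsum_mul_right
    _ ≤ _ := by gcongr; exact tsum_shift_le θ u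

end Coefficients

end LagWindow

/-! ### Short-memory processes and the covariances of their products. -/

namespace LagWindow

section ShortMemory

variable {α : Type*} [MeasurableSpace α]

/-- A centered process up to time `T`, built on the innovations `x n` at time `T - n`, whose
autocovariances are `γ` and whose resampling norms are bounded by `θ`. -/
structure ShortMemory (ν : Measure α) [IsProbabilityMeasure ν] (m : ℝ) (T : ℤ) (A : ℝ≥0∞)
    (θ : ℤ → ℝ≥0∞) (Z : ℤ → (ℕ → α) → ℝ) (γ : ℕ → ℝ) : Prop where
  controlled : ∀ t ≤ T, Controlled ν m (Z t) A (fun n => θ (t - T + n))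
  mean : ∀ t ≤ T, ∫ x, Z t x ∂(seqLaw ν) = 0
  cov : ∀ t ≤ T, ∀ j : ℕ, ∫ x, Z t x * Z (t - j) x ∂(seqLaw ν) = γ j
  decay : Decay θ
  summable : ∑' k, θ k ≠ ∞
  bound : A ≠ ∞
  m_gt : 16 < m

lemma tsum_sq_ne_top {a : ℕ → ℝ≥0∞} (ha : ∑' n, a n ≠ ∞) : ∑' n, a n ^ 2 ≠ ∞ := by
  refine ne_top_of_le_ne_top (ENNReal.mul_ne_top ha ha) ?_
  rw [← ENNReal.tsum_mul_left]
  refine ENNReal.tsum_le_tsum fun n => ?_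
  rw [sq]
  gcongr
  exact ENNReal.le_tsum n

namespace ShortMemory

variable {ν : Measure α} [IsProbabilityMeasure ν] {m : ℝ} {T : ℤ} {A : ℝ≥0∞}
  {θ : ℤ → ℝ≥0∞} {Z : ℤ → (ℕ → α) → ℝ} {γ : ℕ → ℝ}

lemma tsum_ne_top (h : ShortMemory ν m T A θ Z γ) (u : ℤ) : ∑' n : ℕ, θ (u + n) ≠ ∞ :=
  ne_top_of_le_ne_top h.summable (tsum_shift_le θ u)

lemma pair (h : ShortMemory ν m T A θ Z γ) {t s : ℤ} (ht : t ≤ T) (hs : s ≤ T) :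
    Controlled ν (m / 2) (fun x => Z t x * Z s x) (A * A)
      (fun n => A * (θ (t - T + n) + θ (s - T + n))) := by
  have hm := h.m_gt
  refine (Controlled.mul (q := m / 2) (by linarith)
    ((h.controlled t ht).mono_exponent (by linarith))
    ((h.controlled s hs).mono_exponent (by linarith))).mono le_rfl fun n => le_of_eq ?_
  ring

lemma enorm_autocov_le (h : ShortMemory ν m T A θ Z γ) (j : ℕ) : ‖γ j‖ₑ ≤ A * A := by
  have hm := h.m_gt
  rw [← h.cov T le_rfl j]
  exact (h.pair le_rfl (by omega)).enorm_integral_le (by linarith)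

lemma enorm_autocov_le_decay (h : ShortMemory ν m T A θ Z γ) (j : ℕ) :
    ‖γ j‖ₑ ≤ (∑' k, θ k) * θ j := by
  have hm := h.m_gt
  have h1 := (h.controlled T le_rfl).enorm_covariance_le (by linarith)
    (h.controlled (T - j) (by omega)) h.bound h.bound (tsum_sq_ne_top (h.tsum_ne_top _))
  rw [h.cov T le_rfl j, h.mean T le_rfl, zero_mul, sub_zero] at h1
  refine h1.trans (h.decay.tsum_mul_le (by positivity) ?_)
  rw [show T - T - (T - j - T) = (j : ℤ) by ring]
  exact le_abs_self _

lemma centered (h : ShortMemory ν m T A θ Z γ) {t : ℤ} (ht : t ≤ T) (j : ℕ) :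
    Controlled ν (m / 2) (fun x => Z t x * Z (t - j) x - γ j) (A * A + A * A)
      (fun n => A * (θ (t - T + n) + θ (t - j - T + n))) := by
  have hm := h.m_gt
  exact ((h.pair ht (by omega : t - j ≤ T)).sub_const (by linarith) (γ j)).mono
    (by gcongr; exact h.enorm_autocov_le j) fun n => le_rfl

lemma centered_mul_centered (h : ShortMemory ν m T A θ Z γ) {t s : ℤ} (ht : t ≤ T) (hs : s ≤ T)
    (j₁ j₂ : ℕ) :
    Controlled ν (m / 4)
      (fun x => (Z t x * Z (t - j₁) x - γ j₁) * (Z s x * Z (s - j₂) x - γ j₂))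
      ((A * A + A * A) * (A * A + A * A))
      (fun n => (A * A + A * A) * A *
        ((θ (t - T + n) + θ (t - j₁ - T + n)) + (θ (s - T + n) + θ (s - j₂ - T + n)))) := by
  have hm := h.m_gt
  refine (Controlled.mul (q := m / 4) (by linarith)
    ((h.centered ht j₁).mono_exponent (by linarith))
    ((h.centered hs j₂).mono_exponent (by linarith))).mono le_rfl fun n => le_of_eq ?_
  ring

lemma integral_centered_mul (h : ShortMemory ν m T A θ Z γ) {t s : ℤ} (ht : t ≤ T) (hs : s ≤ T)
    (j₁ j₂ : ℕ) :
    ∫ x, (Z t x * Z (t - j₁) x - γ j₁) * (Z s x * Z (s - j₂) x - γ j₂) ∂(seqLaw ν) =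
      ∫ x, (Z t x * Z (t - j₁) x) * (Z s x * Z (s - j₂) x) ∂(seqLaw ν) - γ j₁ * γ j₂ := by
  have hm := h.m_gt
  have hAA : A * A ≠ ∞ := ENNReal.mul_ne_top h.bound h.bound
  have m1 := ((h.pair ht (by omega : t - j₁ ≤ T)).mono_exponent
    (by linarith : (2 : ℝ) ≤ m / 2)).memLp hAA
  have m2 := ((h.pair hs (by omega : s - j₂ ≤ T)).mono_exponent
    (by linarith : (2 : ℝ) ≤ m / 2)).memLp hAA
  have i1 := MemLp.integrable_of_one_le one_le_two m1
  have i2 := MemLp.integrable_of_one_le one_le_two m2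
  have i3 := MemLp.integrable_mul_of_two m1 m2
  have e : ∀ x, (Z t x * Z (t - j₁) x - γ j₁) * (Z s x * Z (s - j₂) x - γ j₂) =
      (Z t x * Z (t - j₁) x) * (Z s x * Z (s - j₂) x) - γ j₂ * (Z t x * Z (t - j₁) x) -
        γ j₁ * (Z s x * Z (s - j₂) x) + γ j₁ * γ j₂ := fun x => by ring
  simp_rw [e]
  have i4 : Integrable (fun x => (Z t x * Z (t - j₁) x) * (Z s x * Z (s - j₂) x) -
      γ j₂ * (Z t x * Z (t - j₁) x)) (seqLaw ν) := i3.sub (i1.const_mul _)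
  have i5 : Integrable (fun x => (Z t x * Z (t - j₁) x) * (Z s x * Z (s - j₂) x) -
      γ j₂ * (Z t x * Z (t - j₁) x) - γ j₁ * (Z s x * Z (s - j₂) x)) (seqLaw ν) :=
    i4.sub (i2.const_mul _)
  rw [integral_add i5 (integrable_const _), integral_sub i4 (i2.const_mul _),
    integral_sub i3 (i1.const_mul _), integral_const_mul, integral_const_mul, h.cov t ht,
    h.cov s hs, integral_const, probReal_univ, one_smul]
  ring

/-- Both times `s` and `s - j₂` lie at least `d` after `t`, and hence after `t - j₁`. The quantity
is the covariance of the two pair products, and each of the four cross sums is small. -/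
lemma enorm_integral_le_of_gap (h : ShortMemory ν m T A θ Z γ) {t s d : ℤ} (hts : t ≤ s)
    (hs : s ≤ T) (j₁ j₂ : ℕ) (hd : 0 ≤ d) (h1 : d ≤ s - t) (h2 : d ≤ s - j₂ - t) :
    ‖∫ x, (Z t x * Z (t - j₁) x) * (Z s x * Z (s - j₂) x) ∂(seqLaw ν) - γ j₁ * γ j₂‖ₑ ≤
      4 * (A * A) * (∑' k, θ k) * θ d := by
  have hm := h.m_gt
  have ht : t ≤ T := hts.trans hs
  have hAA : A * A ≠ ∞ := ENNReal.mul_ne_top h.bound h.bound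
  have hfin : ∑' n : ℕ, A * (θ (t - T + n) + θ (t - j₁ - T + n)) ≠ ∞ := by
    rw [ENNReal.tsum_mul_left, ENNReal.tsum_add]
    exact ENNReal.mul_ne_top h.bound (ENNReal.add_ne_top.2 ⟨h.tsum_ne_top _, h.tsum_ne_top _⟩)
  have key := (h.pair ht (by omega : t - j₁ ≤ T)).enorm_covariance_le (by linarith)
    (h.pair hs (by omega : s - j₂ ≤ T)) hAA hAA (tsum_sq_ne_top hfin)
  rw [h.cov t ht, h.cov s hs] at key
  refine key.trans ?_
  have e : ∀ n : ℕ, A * (θ (t - T + n) + θ (t - j₁ - T + n)) *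
      (A * (θ (s - T + n) + θ (s - j₂ - T + n))) =
      A * A * (θ (t - T + n) * θ (s - T + n) + θ (t - T + n) * θ (s - j₂ - T + n) +
        θ (t - j₁ - T + n) * θ (s - T + n) + θ (t - j₁ - T + n) * θ (s - j₂ - T + n)) :=
    fun n => by ring
  simp_rw [e]
  rw [ENNReal.tsum_mul_left, ENNReal.tsum_add, ENNReal.tsum_add, ENNReal.tsum_add]
  have b : ∀ u v : ℤ, u + d ≤ v → ∑' n : ℕ, θ (u - T + n) * θ (v - T + n) ≤
      (∑' k, θ k) * θ d := fun u v huv => h.decay.tsum_mul_le hd (by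
    rw [abs_sub_comm]
    exact le_trans (by linarith) (le_abs_self _))
  calc _ ≤ A * A * ((∑' k, θ k) * θ d + (∑' k, θ k) * θ d + (∑' k, θ k) * θ d +
        (∑' k, θ k) * θ d) := by
        gcongr
        · exact b _ _ (by linarith)
        · exact b _ _ (by linarith)
        · exact b _ _ (by omega)
        · exact b _ _ (by omega)
    _ = _ := by ring

/-- The time `s` lies at least `d` after the other three, so the fourth moment is the covariance of
the centered `Z s` with a triple product and is small by itself. The product of autocovariances is
small separately, since `j₂` is at least `d`. -/
lemma enorm_integral_le_of_isolated (h : ShortMemory ν m T A θ Z γ) {t s d : ℤ} (hts : t ≤ s)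
    (hs : s ≤ T) (j₁ j₂ : ℕ) (hd : 0 ≤ d) (h1 : d ≤ s - t) (h2 : d ≤ j₂) :
    ‖∫ x, (Z t x * Z (t - j₁) x) * (Z s x * Z (s - j₂) x) ∂(seqLaw ν) - γ j₁ * γ j₂‖ₑ ≤
      4 * (A * A) * (∑' k, θ k) * θ d := by
  have hm := h.m_gt
  have ht : t ≤ T := hts.trans hs
  have hAA : A * A ≠ ∞ := ENNReal.mul_ne_top h.bound h.bound
  -- The triple product is controlled in L^{m/4} and the covariance bound asks for an exponent of at
  -- least 4, which m > 16 provides.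
  have htriple := Controlled.mul (q := m / 4) (by linarith)
    ((h.controlled (s - j₂) (by omega)).mono_exponent (by linarith))
    ((h.pair ht (by omega : t - j₁ ≤ T)).mono_exponent (by linarith))
  have key := ((h.controlled s hs).mono_exponent (by linarith)).enorm_covariance_le (by linarith)
    htriple h.bound (ENNReal.mul_ne_top h.bound hAA) (tsum_sq_ne_top (h.tsum_ne_top _))
  rw [h.mean s hs, zero_mul, sub_zero] at key
  have e : ∀ n : ℕ, θ (s - T + n) * (θ (s - j₂ - T + n) * (A * A) +
      A * (A * (θ (t - T + n) + θ (t - j₁ - T + n)))) =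
      A * A * (θ (s - T + n) * θ (s - j₂ - T + n) + θ (s - T + n) * θ (t - T + n) +
        θ (s - T + n) * θ (t - j₁ - T + n)) := fun n => by ring
  simp_rw [e] at key
  rw [ENNReal.tsum_mul_left, ENNReal.tsum_add, ENNReal.tsum_add] at key
  have b : ∀ u v : ℤ, v + d ≤ u → ∑' n : ℕ, θ (u - T + n) * θ (v - T + n) ≤
      (∑' k, θ k) * θ d := fun u v huv => h.decay.tsum_mul_le hd
    (le_trans (by linarith) (le_abs_self _))
  have e2 : ∀ x, (Z t x * Z (t - j₁) x) * (Z s x * Z (s - j₂) x) =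
      Z s x * (Z (s - j₂) x * (Z t x * Z (t - j₁) x)) := fun x => by ring
  simp_rw [e2]
  have e3 : ‖γ j₁ * γ j₂‖ₑ ≤ A * A * ((∑' k, θ k) * θ d) := by
    rw [enorm_mul]
    exact mul_le_mul' (h.enorm_autocov_le j₁) ((h.enorm_autocov_le_decay j₂).trans
      (by gcongr; exact h.decay.anti _ _ hd h2))
  calc _ ≤ A * A * ((∑' k, θ k) * θ d + (∑' k, θ k) * θ d + (∑' k, θ k) * θ d) +
        A * A * ((∑' k, θ k) * θ d) := by
        refine enorm_sub_le.trans (add_le_add (key.trans ?_) e3)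
        gcongr
        · exact b _ _ (by omega)
        · exact b _ _ (by linarith)
        · exact b _ _ (by omega)
    _ = _ := by ring

/-- The covariances of products of the process decay with the distance in time, uniformly in
the lags. -/
lemma enorm_integral_centered_mul_le (h : ShortMemory ν m T A θ Z γ) {t s : ℤ} (ht : t ≤ T)
    (hs : s ≤ T) (j₁ j₂ : ℕ) :
    ‖∫ x, (Z t x * Z (t - j₁) x - γ j₁) * (Z s x * Z (s - j₂) x - γ j₂) ∂(seqLaw ν)‖ₑ ≤
      4 * (A * A) * (∑' k, θ k) * θ (|t - s| / 2) := by
  wlog hts : t ≤ s generalizing t s j₁ j₂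
  · have := this hs ht j₂ j₁ (le_of_not_ge hts)
    rw [abs_sub_comm]
    refine le_trans (le_of_eq ?_) this
    congr 2
    funext x
    ring
  rw [h.integral_centered_mul ht hs, abs_sub_comm, abs_of_nonneg (sub_nonneg.2 hts)]
  -- With d the integer half of s - t: a lag `j₂` of at least d isolates `s`, while a lag of at most
  -- d leaves `s - j₂` still at distance d after `t`.
  rcases le_total ((s - t) / 2) (j₂ : ℤ) with hj | hj
  · exact h.enorm_integral_le_of_isolated hts hs j₁ j₂ (by omega) (by omega) hj
  · exact h.enorm_integral_le_of_gap hts hs j₁ j₂ (by omega) (by omega) (by omega)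

end ShortMemory

end ShortMemory

end LagWindow

/-! ### Concentration of sample autocovariances and quadratic forms. -/

namespace LagWindow

/-- A Schur-type bound: row sums handle the part depending on `t`, column sums the part depending on
`s`. -/
lemma sum_sum_mul_add_le {I J : Finset ℕ} {w : ℕ → ℕ → ℝ≥0∞} {k c : ℝ≥0∞} {p r : ℕ → ℝ≥0∞}
    (hrow : ∀ t ∈ I, ∑ s ∈ J, w t s ≤ k) (hcol : ∀ s ∈ J, ∑ t ∈ I, w t s ≤ k) :
    ∑ t ∈ I, ∑ s ∈ J, w t s * (c * (p t + r s)) ≤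
      c * (k * ∑ t ∈ I, p t + k * ∑ s ∈ J, r s) := by
  have e : ∑ t ∈ I, ∑ s ∈ J, w t s * (c * (p t + r s)) =
      c * (∑ t ∈ I, (∑ s ∈ J, w t s) * p t + ∑ s ∈ J, (∑ t ∈ I, w t s) * r s) := by
    have e1 : ∀ t s, w t s * (c * (p t + r s)) = c * (w t s * p t) + c * (w t s * r s) :=
      fun t s => by ring
    simp_rw [e1, Finset.sum_add_distrib, mul_add, Finset.sum_mul, Finset.mul_sum]
    congr 1
    rw [Finset.sum_comm]
  rw [e, Finset.mul_sum, Finset.mul_sum]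
  gcongr with t ht s hs
  · exact hrow t ht
  · exact hcol s hs

lemma sum_sum_le_card_mul {I J : Finset ℕ} {w : ℕ → ℕ → ℝ≥0∞} {k : ℝ≥0∞} {T : ℕ}
    (hI : I.card ≤ T) (hrow : ∀ t ∈ I, ∑ s ∈ J, w t s ≤ k) :
    ∑ t ∈ I, ∑ s ∈ J, w t s ≤ T * k := by
  refine (Finset.sum_le_card_nsmul I _ k hrow).trans ?_
  rw [nsmul_eq_mul]
  gcongr

namespace ShortMemory

variable {α : Type*} [MeasurableSpace α] {ν : Measure α} [IsProbabilityMeasure ν] {m : ℝ} {T : ℕ}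
  {A : ℝ≥0∞} {θ : ℤ → ℝ≥0∞} {Z : ℤ → (ℕ → α) → ℝ} {γ : ℕ → ℝ}

lemma integral_centered (h : ShortMemory ν m T A θ Z γ) {t : ℤ} (ht : t ≤ T) (j : ℕ) :
    ∫ x, (Z t x * Z (t - j) x - γ j) ∂(seqLaw ν) = 0 := by
  have hm := h.m_gt
  have i1 := MemLp.integrable_of_one_le (by linarith : 1 ≤ m / 2)
    ((h.pair ht (by omega : t - j ≤ T)).memLp (ENNReal.mul_ne_top h.bound h.bound))
  rw [integral_sub i1 (integrable_const _), h.cov t ht, integral_const, probReal_univ, one_smul,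
    sub_self]

/-- One innovation moves the whole sum by at most U = 2A Σθ, since its effects on the successive
terms are summable; over all innovations the effects add up to at most T U. The concentration
constant `D` enters as a hypothesis so that it is fixed before `T` and `j`. -/
lemma eLpNorm_sum_centered_le (h : ShortMemory ν m T A θ Z γ) {D : ℝ≥0∞} (j : ℕ)
    (hD : ∀ (f : (ℕ → α) → ℝ) (B : ℝ≥0∞) (a : ℕ → ℝ≥0∞),
      Controlled ν (m / 2) f B a → B ≠ ∞ → ∀ (U τ : ℝ≥0∞), (∀ n, a n ≤ U) →
      ∑' n, a n ≤ τ ^ 2 * U →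
      eLpNorm (fun x => f x - ∫ y, f y ∂(seqLaw ν)) (ENNReal.ofReal (m / 2)) (seqLaw ν) ≤
        D * (U * τ)) {τ : ℝ≥0∞} (hτ : τ ^ 2 = T) :
    eLpNorm (fun x => ∑ t ∈ Finset.Icc (j + 1) T, (Z t x * Z (t - j) x - γ j))
      (ENNReal.ofReal (m / 2)) (seqLaw ν) ≤ D * (A * (∑' k, θ k + ∑' k, θ k) * τ) := by
  have hm := h.m_gt
  have hle : ∀ t ∈ Finset.Icc (j + 1) T, (t : ℤ) ≤ T := fun t ht => by
    have := (Finset.mem_Icc.1 ht).2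
    exact_mod_cast this
  have hfin : A * A + A * A ≠ ∞ := by
    have := h.bound
    finiteness
  have hc := Controlled.sum (by linarith : 1 ≤ m / 2) (Finset.Icc (j + 1) T)
    fun t ht => h.centered (hle t ht) j
  have := hD _ _ _ hc (ENNReal.sum_ne_top.2 fun _ _ => hfin) (A * (∑' k, θ k + ∑' k, θ k)) τ ?_ ?_
  · rw [integral_finsetSum] at this
    · rw [Finset.sum_congr rfl fun t ht => h.integral_centered (hle t ht) j] at this
      simpa using this
    · exact fun t ht => MemLp.integrable_of_one_le (by linarith : 1 ≤ m / 2)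
        ((h.centered (hle t ht) j).memLp hfin)
  · intro n
    rw [← Finset.mul_sum, Finset.sum_add_distrib]
    gcongr
    · simp_rw [fun t : ℕ => show (t : ℤ) - T + n = t + (n - T) by ring]
      exact sum_shift_le θ _ _
    · simp_rw [fun t : ℕ => show (t : ℤ) - j - T + n = t + (n - j - T) by ring]
      exact sum_shift_le θ _ _
  · rw [Summable.tsum_finsetSum fun _ _ => ENNReal.summable]
    refine (Finset.sum_le_card_nsmul _ _ (A * (∑' k, θ k + ∑' k, θ k)) fun t _ => ?_).trans ?_
    · rw [ENNReal.tsum_mul_left, ENNReal.tsum_add]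
      gcongr <;> exact tsum_shift_le θ _
    · rw [nsmul_eq_mul, hτ]
      gcongr
      simp

/-- The first moment of the dependence coefficients which enters the bias bounds. -/
noncomputable def firstMoment (θ : ℤ → ℝ≥0∞) : ℝ≥0∞ :=
  ∑' k : ℤ, (k.natAbs : ℝ≥0∞) * θ (|k| / 2)

/-- Needed because γ̂(j) divides a sum of T - j terms by T, which biases it by jγ(j)/T. -/
lemma mul_enorm_autocov_le (h : ShortMemory ν m T A θ Z γ) (j : ℕ) :
    (j : ℝ≥0∞) * ‖γ j‖ₑ ≤ (∑' k, θ k) * firstMoment θ := by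
  have h1 : (j : ℝ≥0∞) * θ ((j : ℤ) / 2) ≤ firstMoment θ := by
    have := ENNReal.le_tsum (f := fun k : ℤ => (k.natAbs : ℝ≥0∞) * θ (|k| / 2)) (j : ℤ)
    simpa [firstMoment] using this
  calc (j : ℝ≥0∞) * ‖γ j‖ₑ ≤ j * ((∑' k, θ k) * θ ((j : ℤ) / 2)) := by
        gcongr
        refine (h.enorm_autocov_le_decay j).trans ?_
        gcongr
        exact h.decay.anti _ _ (by omega) (by omega)
    _ = (∑' k, θ k) * (j * θ ((j : ℤ) / 2)) := by ring
    _ ≤ _ := by gcongr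

lemma measurable (h : ShortMemory ν m T A θ Z γ) {t : ℤ} (ht : t ≤ T) : Measurable (Z t) :=
  (h.controlled t ht).measurable

lemma measurable_sampleAutocov (h : ShortMemory ν m T A θ Z γ) (j : ℕ) :
    Measurable (sampleAutocov Z T j) := by
  unfold sampleAutocov
  refine Measurable.const_mul (Finset.measurable_fun_sum _ fun t ht => ?_) _
  have ht' : (t : ℤ) ≤ T := by exact_mod_cast (Finset.mem_Icc.1 ht).2
  exact (h.measurable ht').mul (h.measurable (by omega))

lemma eLpNorm_sampleAutocov_sub_le (h : ShortMemory ν m T A θ Z γ) {D : ℝ≥0∞} {j : ℕ} (hj : j ≤ T)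
    (hT : 0 < T)
    (hD : ∀ (f : (ℕ → α) → ℝ) (B : ℝ≥0∞) (a : ℕ → ℝ≥0∞),
      Controlled ν (m / 2) f B a → B ≠ ∞ → ∀ (U τ : ℝ≥0∞), (∀ n, a n ≤ U) →
      ∑' n, a n ≤ τ ^ 2 * U →
      eLpNorm (fun x => f x - ∫ y, f y ∂(seqLaw ν)) (ENNReal.ofReal (m / 2)) (seqLaw ν) ≤
        D * (U * τ)) {τ : ℝ≥0∞} (hτ : τ ^ 2 = T) (hτ1 : 1 ≤ τ) :
    eLpNorm (fun x => γ j - sampleAutocov Z T j x) (ENNReal.ofReal (m / 2)) (seqLaw ν) ≤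
      ‖1 / (T : ℝ)‖ₑ *
        ((D * (A * (∑' k, θ k + ∑' k, θ k)) + (∑' k, θ k) * firstMoment θ) * τ) := by
  have hm := h.m_gt
  have hT' : (T : ℝ) ≠ 0 := by positivity
  have e : (fun x => γ j - sampleAutocov Z T j x) = (1 / (T : ℝ)) •
      ((fun _ => (j : ℝ) * γ j) - fun x => ∑ t ∈ Finset.Icc (j + 1) T,
        (Z t x * Z (t - j) x - γ j)) := by
    funext x
    simp only [sampleAutocov, Pi.smul_apply, Pi.sub_apply, smul_eq_mul, Finset.sum_sub_distrib,
      Finset.sum_const, Nat.card_Icc, nsmul_eq_mul]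
    rw [show T + 1 - (j + 1) = T - j by omega, Nat.cast_sub hj]
    field_simp
    ring
  rw [e]
  refine (eLpNorm_const_smul _ _ _ _).le.trans ?_
  gcongr
  have hm2 : (1 : ℝ≥0∞) ≤ ENNReal.ofReal (m / 2) := by
    rw [ENNReal.one_le_ofReal]; linarith
  refine (eLpNorm_sub_le aestronglyMeasurable_const ?_ hm2).trans ?_
  · refine Measurable.aestronglyMeasurable (Finset.measurable_fun_sum _ fun t ht => ?_)
    have ht' : (t : ℤ) ≤ T := by exact_mod_cast (Finset.mem_Icc.1 ht).2
    exact ((h.measurable ht').mul (h.measurable (by omega))).sub_const _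
  · rw [eLpNorm_const _ (by simpa using by linarith) (NeZero.ne _), add_comm]
    simp only [measure_univ, ENNReal.one_rpow, mul_one]
    rw [add_mul]
    refine add_le_add ((h.eLpNorm_sum_centered_le j hD hτ).trans_eq (by ring)) ?_
    rw [enorm_mul]
    have : ‖(j : ℝ)‖ₑ = (j : ℝ≥0∞) := by
      rw [Real.enorm_eq_ofReal (by positivity), ENNReal.ofReal_natCast]
    rw [this]
    exact (h.mul_enorm_autocov_le j).trans (le_mul_of_one_le_right zero_le hτ1)

/-- Each of the four factors reacts to an innovation with total size Σθ, and weighting costs a row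
or column sum `k`. So one innovation moves the form by at most U = 2A²·A·4Σθ·k, and all of them
together by at most T U. -/
lemma eLpNorm_quadratic_sub_le (h : ShortMemory ν m T A θ Z γ) {D : ℝ≥0∞} (j₁ j₂ : ℕ)
    (hD : ∀ (f : (ℕ → α) → ℝ) (B : ℝ≥0∞) (a : ℕ → ℝ≥0∞),
      Controlled ν (m / 4) f B a → B ≠ ∞ → ∀ (U τ : ℝ≥0∞), (∀ n, a n ≤ U) →
      ∑' n, a n ≤ τ ^ 2 * U →
      eLpNorm (fun x => f x - ∫ y, f y ∂(seqLaw ν)) (ENNReal.ofReal (m / 4)) (seqLaw ν) ≤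
        D * (U * τ)) {τ : ℝ≥0∞} (hτ : τ ^ 2 = T) {w : ℕ → ℕ → ℝ} {k : ℝ≥0∞}
    (hrow : ∀ t, ∑ s ∈ Finset.Icc (j₂ + 1) T, ‖w t s‖ₑ ≤ k)
    (hcol : ∀ s, ∑ t ∈ Finset.Icc (j₁ + 1) T, ‖w t s‖ₑ ≤ k) :
    eLpNorm (fun x => ∑ t ∈ Finset.Icc (j₁ + 1) T, ∑ s ∈ Finset.Icc (j₂ + 1) T,
        w t s * ((Z t x * Z (t - j₁) x - γ j₁) * (Z s x * Z (s - j₂) x - γ j₂)) -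
        ∑ t ∈ Finset.Icc (j₁ + 1) T, ∑ s ∈ Finset.Icc (j₂ + 1) T, w t s *
          ∫ x, (Z t x * Z (t - j₁) x - γ j₁) * (Z s x * Z (s - j₂) x - γ j₂) ∂(seqLaw ν))
      (ENNReal.ofReal (m / 4)) (seqLaw ν) ≤
      D * ((A * A + A * A) * A * (4 * (∑' k, θ k)) * (k * τ)) := by
  have hm := h.m_gt
  set Θ := ∑' k, θ k with hΘ
  have hle : ∀ {j : ℕ}, ∀ t ∈ Finset.Icc (j + 1) T, (t : ℤ) ≤ T := fun t ht => by
    have := (Finset.mem_Icc.1 ht).2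
    exact_mod_cast this
  have hfin : (A * A + A * A) * (A * A + A * A) ≠ ∞ := by
    have := h.bound
    finiteness
  have hm1 : 1 ≤ m / 4 := by linarith
  have hcard : ∀ j, (Finset.Icc (j + 1) T).card ≤ T := fun j => by simp
  have hsum : ∀ (I : Finset ℕ) (u : ℤ) (n : ℕ), ∑ t ∈ I, θ (t - u + n) ≤ Θ := fun I u n => by
    simp_rw [fun t : ℕ => show (t : ℤ) - u + n = t + (n - u) by ring]
    exact sum_shift_le θ _ _
  have hsum' : ∀ (I : Finset ℕ) (u v : ℤ) (n : ℕ), ∑ t ∈ I, θ (t - u - v + n) ≤ Θ :=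
    fun I u v n => by
      simp_rw [sub_sub]
      exact hsum I (u + v) n
  have hc := Controlled.sum hm1 (Finset.Icc (j₁ + 1) T) fun t ht =>
    Controlled.sum hm1 (Finset.Icc (j₂ + 1) T) fun s hs =>
      (h.centered_mul_centered (hle t ht) (hle s hs) j₁ j₂).const_mul (w t s)
  have := hD _ _ _ hc (ENNReal.sum_ne_top.2 fun t _ => ENNReal.sum_ne_top.2 fun s _ =>
    ENNReal.mul_ne_top enorm_ne_top hfin) ((A * A + A * A) * A * (4 * Θ) * k) τ ?_ ?_
  · rw [integral_finsetSum] at this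
    · rw [Finset.sum_congr rfl fun t ht => integral_finsetSum (Finset.Icc (j₂ + 1) T) ?_] at this
      · simp_rw [integral_const_mul] at this
        refine this.trans_eq ?_
        ring
      · exact fun s hs => (MemLp.integrable_of_one_le hm1
          ((h.centered_mul_centered (hle t ht) (hle s hs) j₁ j₂).memLp hfin)).const_mul _
    · exact fun t ht => integrable_finsetSum _ fun s hs => (MemLp.integrable_of_one_le hm1
          ((h.centered_mul_centered (hle t ht) (hle s hs) j₁ j₂).memLp hfin)).const_mul _
  · intro n
    refine (sum_sum_mul_add_le (fun t _ => hrow t) (fun s _ => hcol s)).trans ?_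
    rw [Finset.sum_add_distrib, Finset.sum_add_distrib]
    calc _ ≤ (A * A + A * A) * A * (k * (Θ + Θ) + k * (Θ + Θ)) := by
          gcongr
          · exact hsum _ _ _
          · exact hsum' _ _ _ _
          · exact hsum _ _ _
          · exact hsum' _ _ _ _
      _ = _ := by ring
  · rw [Summable.tsum_finsetSum fun _ _ => ENNReal.summable]
    simp_rw [Summable.tsum_finsetSum fun _ _ => ENNReal.summable, ENNReal.tsum_mul_left,
      ENNReal.tsum_add]
    calc _ ≤ ∑ t ∈ Finset.Icc (j₁ + 1) T, ∑ s ∈ Finset.Icc (j₂ + 1) T, ‖w t s‖ₑ *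
          ((A * A + A * A) * A * ((Θ + Θ) + (Θ + Θ))) := by
          gcongr <;> exact tsum_shift_le θ _
      _ = (∑ t ∈ Finset.Icc (j₁ + 1) T, ∑ s ∈ Finset.Icc (j₂ + 1) T, ‖w t s‖ₑ) *
          ((A * A + A * A) * A * ((Θ + Θ) + (Θ + Θ))) := by
          simp_rw [Finset.sum_mul]
      _ ≤ (T * k) * ((A * A + A * A) * A * ((Θ + Θ) + (Θ + Θ))) := by
          gcongr
          exact sum_sum_le_card_mul (hcard _) fun t _ => hrow t
      _ = _ := by rw [hτ]; ring

end ShortMemory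

end LagWindow

/-! ### Fluctuation and bias of the lag window estimator. -/

namespace LagWindow

namespace ShortMemory

variable {α : Type*} [MeasurableSpace α] {ν : Measure α} [IsProbabilityMeasure ν] {m : ℝ} {T : ℕ}
  {A : ℝ≥0∞} {θ : ℤ → ℝ≥0∞} {Z : ℤ → (ℕ → α) → ℝ} {γ : ℕ → ℝ}

lemma enorm_one_div_mul_natCast {T : ℕ} (hT : 0 < T) : ‖1 / (T : ℝ)‖ₑ * (T : ℝ≥0∞) = 1 := by
  have h1 : (T : ℝ≥0∞) = ‖(T : ℝ)‖ₑ := by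
    rw [Real.enorm_eq_ofReal (by positivity), ENNReal.ofReal_natCast]
  rw [h1, ← enorm_mul, one_div_mul_cancel (by positivity), enorm_one]

/-- The constant in the bound for the sample autocovariances. -/
noncomputable def autocovConst (A : ℝ≥0∞) (θ : ℤ → ℝ≥0∞) (D : ℝ≥0∞) : ℝ≥0∞ :=
  D * (A * (∑' k, θ k + ∑' k, θ k)) + (∑' k, θ k) * firstMoment θ

/-- The constant in the bound for the lag window estimator. -/
noncomputable def estimatorConst (A : ℝ≥0∞) (θ : ℤ → ℝ≥0∞) (D₂ D₄ : ℝ≥0∞) : ℝ≥0∞ :=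
  D₄ * ((A * A + A * A) * A * (4 * (∑' k, θ k))) + autocovConst A θ D₂ * (A * A + A * A) +
    autocovConst A θ D₂ * (A * A + A * A) + autocovConst A θ D₂ * autocovConst A θ D₂

/-- Expanding around the true autocovariances leaves the quadratic form plus terms with a factor γ -
γ̂. That factor has size 1/√T in L^{m/2}, so the crude bound T k for the accompanying weighted sums
already gives k√T. -/
lemma eLpNorm_estimator_sub_le (h : ShortMemory ν m T A θ Z γ) {D₂ D₄ : ℝ≥0∞} {j₁ j₂ : ℕ}
    (hj₁ : j₁ ≤ T) (hj₂ : j₂ ≤ T) (hT : 0 < T)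
    (hD₂ : ∀ (f : (ℕ → α) → ℝ) (B : ℝ≥0∞) (a : ℕ → ℝ≥0∞),
      Controlled ν (m / 2) f B a → B ≠ ∞ → ∀ (U τ : ℝ≥0∞), (∀ n, a n ≤ U) →
      ∑' n, a n ≤ τ ^ 2 * U →
      eLpNorm (fun x => f x - ∫ y, f y ∂(seqLaw ν)) (ENNReal.ofReal (m / 2)) (seqLaw ν) ≤
        D₂ * (U * τ))
    (hD₄ : ∀ (f : (ℕ → α) → ℝ) (B : ℝ≥0∞) (a : ℕ → ℝ≥0∞),
      Controlled ν (m / 4) f B a → B ≠ ∞ → ∀ (U τ : ℝ≥0∞), (∀ n, a n ≤ U) →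
      ∑' n, a n ≤ τ ^ 2 * U →
      eLpNorm (fun x => f x - ∫ y, f y ∂(seqLaw ν)) (ENNReal.ofReal (m / 4)) (seqLaw ν) ≤
        D₄ * (U * τ)) {τ : ℝ≥0∞} (hτ : τ ^ 2 = T) (hτ1 : 1 ≤ τ) {w : ℕ → ℕ → ℝ} {k : ℝ≥0∞}
    (hrow : ∀ t, ∑ s ∈ Finset.Icc (j₂ + 1) T, ‖w t s‖ₑ ≤ k)
    (hcol : ∀ s, ∑ t ∈ Finset.Icc (j₁ + 1) T, ‖w t s‖ₑ ≤ k) :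
    eLpNorm (fun x => (1 / (T : ℝ)) * ∑ t ∈ Finset.Icc (j₁ + 1) T, ∑ s ∈ Finset.Icc (j₂ + 1) T,
        w t s * (Z t x * Z (t - j₁) x - sampleAutocov Z T j₁ x) *
          (Z s x * Z (s - j₂) x - sampleAutocov Z T j₂ x) -
        (1 / (T : ℝ)) * ∑ t ∈ Finset.Icc (j₁ + 1) T, ∑ s ∈ Finset.Icc (j₂ + 1) T, w t s *
          ∫ x, (Z t x * Z (t - j₁) x - γ j₁) * (Z s x * Z (s - j₂) x - γ j₂) ∂(seqLaw ν))
      (ENNReal.ofReal (m / 4)) (seqLaw ν) ≤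
      ‖1 / (T : ℝ)‖ₑ * (estimatorConst A θ D₂ D₄ * (k * τ)) := by
  have hm := h.m_gt
  have hm4 : (1 : ℝ≥0∞) ≤ ENNReal.ofReal (m / 4) := by
    rw [ENNReal.one_le_ofReal]; linarith
  have hle : ∀ {j : ℕ}, ∀ t ∈ Finset.Icc (j + 1) T, (t : ℤ) ≤ T := fun t ht => by
    have := (Finset.mem_Icc.1 ht).2
    exact_mod_cast this
  have hcard : ∀ j, (Finset.Icc (j + 1) T).card ≤ T := fun j => by simp
  set I := Finset.Icc (j₁ + 1) T with hI
  set J := Finset.Icc (j₂ + 1) T with hJ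
  set G := A * A + A * A with hG
  set Q : (ℕ → α) → ℝ := fun x => ∑ t ∈ I, ∑ s ∈ J,
        w t s * ((Z t x * Z (t - j₁) x - γ j₁) * (Z s x * Z (s - j₂) x - γ j₂)) with hQ
  set E : ℝ := ∑ t ∈ I, ∑ s ∈ J, w t s *
    ∫ x, (Z t x * Z (t - j₁) x - γ j₁) * (Z s x * Z (s - j₂) x - γ j₂) ∂(seqLaw ν) with hE
  set u₁ : (ℕ → α) → ℝ := fun x => γ j₁ - sampleAutocov Z T j₁ x with hu₁
  set u₂ : (ℕ → α) → ℝ := fun x => γ j₂ - sampleAutocov Z T j₂ x with hu₂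
  set P₁ : (ℕ → α) → ℝ := fun x => ∑ t ∈ I, ∑ s ∈ J, w t s * (Z t x * Z (t - j₁) x - γ j₁) with hP₁
  set P₂ : (ℕ → α) → ℝ := fun x => ∑ t ∈ I, ∑ s ∈ J, w t s * (Z s x * Z (s - j₂) x - γ j₂) with hP₂
  set W₀ : ℝ := ∑ t ∈ I, ∑ s ∈ J, w t s with hW₀
  have e : (fun x => (1 / (T : ℝ)) * ∑ t ∈ I, ∑ s ∈ J,
        w t s * (Z t x * Z (t - j₁) x - sampleAutocov Z T j₁ x) *
          (Z s x * Z (s - j₂) x - sampleAutocov Z T j₂ x) - (1 / (T : ℝ)) * E) =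
      (1 / (T : ℝ)) • ((fun x => Q x - E) + (fun x => u₂ x * P₁ x) + (fun x => u₁ x * P₂ x) +
        fun x => u₁ x * (u₂ x * W₀)) := by
    funext x
    simp only [Pi.smul_apply, Pi.add_apply, smul_eq_mul]
    rw [← mul_sub]
    congr 1
    rw [add_assoc, add_assoc, sub_add_eq_add_sub]
    congr 1
    simp only [hQ, hP₁, hP₂, hW₀, Finset.mul_sum, ← Finset.sum_add_distrib]
    refine Finset.sum_congr rfl fun t _ => Finset.sum_congr rfl fun s _ => ?_
    simp only [hu₁, hu₂]
    ring
  have hWT : ∑ t ∈ I, ∑ s ∈ J, ‖w t s‖ₑ ≤ T * k := sum_sum_le_card_mul (hcard _) fun t _ => hrow t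
  have mu₁ : Measurable u₁ := measurable_const.sub (h.measurable_sampleAutocov j₁)
  have mu₂ : Measurable u₂ := measurable_const.sub (h.measurable_sampleAutocov j₂)
  have mQ : Measurable Q := Finset.measurable_fun_sum _ fun t ht => Finset.measurable_fun_sum _
    fun s hs => (h.centered_mul_centered (hle t ht) (hle s hs) j₁ j₂).measurable.const_mul _
  have n1 := h.eLpNorm_sampleAutocov_sub_le hj₁ hT hD₂ hτ hτ1
  have n2 := h.eLpNorm_sampleAutocov_sub_le hj₂ hT hD₂ hτ hτ1
  have cP₁ : Controlled ν (m / 2) P₁ (∑ t ∈ I, ∑ s ∈ J, ‖w t s‖ₑ * G) _ :=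
    Controlled.sum (by linarith) I fun t ht => Controlled.sum (by linarith) J fun s _ =>
      (h.centered (hle t ht) j₁).const_mul (w t s)
  have cP₂ : Controlled ν (m / 2) P₂ (∑ t ∈ I, ∑ s ∈ J, ‖w t s‖ₑ * G) _ :=
    Controlled.sum (by linarith) I fun t _ => Controlled.sum (by linarith) J fun s hs =>
      (h.centered (hle s hs) j₂).const_mul (w t s)
  simp_rw [← Finset.sum_mul] at cP₁ cP₂
  have hTT := enorm_one_div_mul_natCast hT
  set r := ‖1 / (T : ℝ)‖ₑ with hr
  set Cu := autocovConst A θ D₂ with hCu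
  have hmm : 2 * (m / 4) = m / 2 := by ring
  have b1 : eLpNorm (fun x => u₂ x * P₁ x) (ENNReal.ofReal (m / 4)) (seqLaw ν) ≤
      Cu * G * (k * τ) := by
    refine (eLpNorm_mul_le_two_mul (by linarith) mu₂ cP₁.measurable).trans ?_
    rw [hmm]
    calc _ ≤ (r * (Cu * τ)) * ((T * k) * G) := mul_le_mul' n2 (cP₁.norm_le.trans (by gcongr))
      _ = (r * T) * (Cu * G * (k * τ)) := by ring
      _ = _ := by rw [hTT, one_mul]
  have b2 : eLpNorm (fun x => u₁ x * P₂ x) (ENNReal.ofReal (m / 4)) (seqLaw ν) ≤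
      Cu * G * (k * τ) := by
    refine (eLpNorm_mul_le_two_mul (by linarith) mu₁ cP₂.measurable).trans ?_
    rw [hmm]
    calc _ ≤ (r * (Cu * τ)) * ((T * k) * G) := mul_le_mul' n1 (cP₂.norm_le.trans (by gcongr))
      _ = (r * T) * (Cu * G * (k * τ)) := by ring
      _ = _ := by rw [hTT, one_mul]
  -- Two factors of size 1/√T against T k give order k, which is enlarged to k τ by τ ≥ 1.
  have b3 : eLpNorm (fun x => u₁ x * (u₂ x * W₀)) (ENNReal.ofReal (m / 4)) (seqLaw ν) ≤
      Cu * Cu * (k * τ) := by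
    refine (eLpNorm_mul_le_two_mul (by linarith) mu₁ (mu₂.mul_const _)).trans ?_
    rw [hmm]
    have hW : ‖W₀‖ₑ ≤ T * k := (enorm_sum_le _ _).trans
      ((Finset.sum_le_sum fun t _ => enorm_sum_le _ _).trans hWT)
    have h5 : eLpNorm (fun x => u₂ x * W₀) (ENNReal.ofReal (m / 2)) (seqLaw ν) ≤
        (T * k) * (r * (Cu * τ)) := by
      simp_rw [mul_comm _ W₀]
      exact (eLpNorm_const_smul W₀ u₂ _ _).le.trans (mul_le_mul' hW n2)
    calc _ ≤ (r * (Cu * τ)) * ((T * k) * (r * (Cu * τ))) := mul_le_mul' n1 h5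
      _ = (r * T) * (Cu * Cu * (k * (r * τ ^ 2))) := by ring
      _ = Cu * Cu * (k * 1) := by rw [hτ, hTT, one_mul]
      _ ≤ _ := by gcongr
  have b0 := h.eLpNorm_quadratic_sub_le j₁ j₂ hD₄ hτ hrow hcol
  rw [e]
  refine (eLpNorm_const_smul _ _ _ _).le.trans ?_
  gcongr
  have mA : AEStronglyMeasurable (fun x => Q x - E) (seqLaw ν) :=
    (mQ.sub_const E).aestronglyMeasurable
  have mB : AEStronglyMeasurable (fun x => u₂ x * P₁ x) (seqLaw ν) :=
    (mu₂.mul cP₁.measurable).aestronglyMeasurable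
  have mC : AEStronglyMeasurable (fun x => u₁ x * P₂ x) (seqLaw ν) :=
    (mu₁.mul cP₂.measurable).aestronglyMeasurable
  have mD : AEStronglyMeasurable (fun x => u₁ x * (u₂ x * W₀)) (seqLaw ν) :=
    (mu₁.mul (mu₂.mul_const _)).aestronglyMeasurable
  refine (eLpNorm_add_le ((mA.add mB).add mC) mD hm4).trans ?_
  refine (add_le_add_left ((eLpNorm_add_le (mA.add mB) mC hm4).trans
    (add_le_add_left (eLpNorm_add_le mA mB hm4) _)) _).trans ?_
  calc _ ≤ D₄ * (G * A * (4 * (∑' k, θ k)) * (k * τ)) + Cu * G * (k * τ) +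
        Cu * G * (k * τ) + Cu * Cu * (k * τ) := by gcongr
    _ = _ := by simp only [estimatorConst]; ring

/-- For each `t`, the error l|t - s| of the weight is summed over `s` against the covariance bound
θ(|t - s|/2), which is what `firstMoment` measures. The factor 1/T cancels the number of values of
`t`. -/
lemma enorm_bias_le (h : ShortMemory ν m T A θ Z γ) (j₁ j₂ : ℕ) (hT : 0 < T)
    {w : ℕ → ℕ → ℝ} {l : ℝ≥0∞} (hw : ∀ t s, ‖w t s - 1‖ₑ ≤ l * ((t : ℤ) - s).natAbs) :
    ‖(1 / (T : ℝ)) * ∑ t ∈ Finset.Icc (j₁ + 1) T, ∑ s ∈ Finset.Icc (j₂ + 1) T, w t s *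
        ∫ x, (Z t x * Z (t - j₁) x - γ j₁) * (Z s x * Z (s - j₂) x - γ j₂) ∂(seqLaw ν) -
      (1 / (T : ℝ)) * ∑ t ∈ Finset.Icc (j₁ + 1) T, ∑ s ∈ Finset.Icc (j₂ + 1) T,
        ∫ x, (Z t x * Z (t - j₁) x - γ j₁) * (Z s x * Z (s - j₂) x - γ j₂) ∂(seqLaw ν)‖ₑ ≤
      4 * (A * A) * (∑' k, θ k) * firstMoment θ * l := by
  set c : ℕ → ℕ → ℝ := fun t s =>
    ∫ x, (Z t x * Z (t - j₁) x - γ j₁) * (Z s x * Z (s - j₂) x - γ j₂) ∂(seqLaw ν) with hc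
  set I := Finset.Icc (j₁ + 1) T with hI
  set J := Finset.Icc (j₂ + 1) T with hJ
  have hle : ∀ {j : ℕ}, ∀ t ∈ Finset.Icc (j + 1) T, (t : ℤ) ≤ T := fun t ht => by
    have := (Finset.mem_Icc.1 ht).2
    exact_mod_cast this
  have hcard : I.card ≤ T := by simp [hI]
  have e : (1 / (T : ℝ)) * ∑ t ∈ I, ∑ s ∈ J, w t s * c t s -
      (1 / (T : ℝ)) * ∑ t ∈ I, ∑ s ∈ J, c t s =
      (1 / (T : ℝ)) * ∑ t ∈ I, ∑ s ∈ J, (w t s - 1) * c t s := by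
    rw [← mul_sub, ← Finset.sum_sub_distrib]
    simp_rw [← Finset.sum_sub_distrib, sub_mul, one_mul]
  rw [e, enorm_mul]
  set H := 4 * (A * A) * (∑' k, θ k) with hH
  have hin : ∀ t ∈ I, ‖∑ s ∈ J, (w t s - 1) * c t s‖ₑ ≤ H * firstMoment θ * l := by
    intro t ht
    calc ‖∑ s ∈ J, (w t s - 1) * c t s‖ₑ ≤ ∑ s ∈ J, ‖(w t s - 1) * c t s‖ₑ := enorm_sum_le _ _
      _ ≤ ∑ s ∈ J, (l * H) * (((t : ℤ) - s).natAbs * θ (|(t : ℤ) - s| / 2)) := by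
        refine Finset.sum_le_sum fun s hs => ?_
        rw [enorm_mul]
        refine (mul_le_mul' (hw t s)
          (h.enorm_integral_centered_mul_le (hle t ht) (hle s hs) j₁ j₂)).trans_eq ?_
        ring
      _ = (l * H) * ∑ s ∈ J, (((t : ℤ) - s).natAbs * θ (|(t : ℤ) - s| / 2)) := by
        rw [Finset.mul_sum]
      _ ≤ (l * H) * firstMoment θ := by
        gcongr
        exact (ENNReal.sum_le_tsum J).trans (ENNReal.tsum_comp_le_tsum_of_injective
          (f := fun n : ℕ => (t : ℤ) - n) (fun a b h => by simpa using h)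
          (fun k : ℤ => (k.natAbs : ℝ≥0∞) * θ (|k| / 2)))
      _ = _ := by ring
  calc _ ≤ ‖1 / (T : ℝ)‖ₑ * (T * (H * firstMoment θ * l)) := by
        gcongr
        refine (enorm_sum_le _ _).trans ((Finset.sum_le_card_nsmul I _ _ hin).trans ?_)
        rw [nsmul_eq_mul]
        gcongr
    _ = _ := by rw [← mul_assoc, enorm_one_div_mul_natCast hT, one_mul]

end ShortMemory

end LagWindow

/-! ### Kernel weights and polynomial coefficients. -/

namespace LagWindow

lemma tsum_int_eq (f : ℤ → ℝ≥0∞) :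
    ∑' k, f k = ∑' n : ℕ, f n + ∑' n : ℕ, f (-(n + 1 : ℤ)) :=
  tsum_of_nat_of_neg_add_one ENNReal.summable ENNReal.summable

lemma tsum_int_le_of_even {f : ℤ → ℝ≥0∞} (hf : ∀ k, f (-k) = f k) :
    ∑' k, f k ≤ 2 * ∑' n : ℕ, f n := by
  rw [tsum_int_eq, two_mul]
  refine add_le_add le_rfl ?_
  simp_rw [hf]
  exact ENNReal.tsum_comp_le_tsum_of_injective (f := fun n : ℕ => n + 1)
    (fun a b h => by simpa using h) (fun n : ℕ => f n)

namespace KernelAssumption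

variable {K : ℝ → ℝ}

lemma eq_abs (hK : KernelAssumption K) (x : ℝ) : K x = K |x| := by
  rcases abs_choice x with h | h <;> rw [h]
  rw [hK.symm]

lemma le_one (hK : KernelAssumption K) (x : ℝ) : K x ≤ 1 := by
  rw [hK.eq_abs, ← hK.map_zero]
  exact hK.antitoneOn (Set.mem_Ici.2 le_rfl) (Set.mem_Ici.2 (abs_nonneg x)) (abs_nonneg x)

/-- Near 0 this is differentiability of K at 0 from the right, carried over by evenness; at distance
at least δ it follows from 0 ≤ K ≤ 1. -/
lemma exists_abs_sub_one_le (hK : KernelAssumption K) :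
    ∃ L : ℝ, 0 < L ∧ ∀ x, |K x - 1| ≤ L * |x| := by
  have hd : DifferentiableWithinAt ℝ K (Set.Ici 0) 0 :=
    (hK.contDiffOn.differentiableOn one_ne_zero) 0 (Set.mem_Ici.2 le_rfl)
  obtain ⟨c, hc⟩ := (hd.isBigO_sub).bound
  obtain ⟨δ, hδ, hball⟩ := Metric.mem_nhdsWithin_iff.1 hc
  refine ⟨max c (1 / δ), lt_max_of_lt_right (by positivity), fun x => ?_⟩
  rw [hK.eq_abs]
  rcases lt_or_ge |x| δ with h | h
  · have := hball ⟨by simpa [Real.dist_eq] using h, Set.mem_Ici.2 (abs_nonneg x)⟩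
    simp only [Set.mem_ofPred_eq, hK.map_zero, sub_zero, Real.norm_eq_abs, abs_abs] at this
    exact this.trans (by gcongr; exact le_max_left _ _)
  · have h1 : |K |x| - 1| ≤ 1 := by
      rw [abs_le]
      constructor <;> linarith [hK.nonneg |x|, hK.le_one |x|]
    calc |K |x| - 1| ≤ 1 := h1
      _ = 1 / δ * δ := by field_simp
      _ ≤ max c (1 / δ) * |x| := by
        gcongr
        exact le_max_right _ _

lemma sum_range_le (hK : KernelAssumption K) {b : ℝ} (hb : 0 < b) (n : ℕ) :
    ∑ i ∈ Finset.range n, K (((i + 1 : ℕ) : ℝ) / b) ≤ b * ∫ x, K x := by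
  have ha : AntitoneOn (fun x => K (x / b)) (Set.Icc (0 : ℝ) (0 + n)) := by
    intro x hx y _ hxy
    have hx0 : 0 ≤ x / b := div_nonneg hx.1 hb.le
    have hxy' : x / b ≤ y / b := by gcongr
    exact hK.antitoneOn (Set.mem_Ici.2 hx0) (Set.mem_Ici.2 (hx0.trans hxy')) hxy'
  have h1 := ha.sum_le_integral
  simp only [zero_add] at h1
  refine h1.trans ?_
  rw [intervalIntegral.integral_comp_div (fun x => K x) hb.ne', smul_eq_mul, zero_div]
  gcongr
  rw [intervalIntegral.integral_of_le (by positivity)]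
  exact setIntegral_le_integral hK.integrable (ae_of_all _ hK.nonneg)

/-- Monotonicity compares the terms with positive index to b∫K. The central term K(0) = 1 is
absorbed by b ≥ 1. -/
lemma tsum_enorm_le (hK : KernelAssumption K) {b : ℝ} (hb : 1 ≤ b) :
    ∑' k : ℤ, ‖K ((k : ℝ) / b)‖ₑ ≤ ENNReal.ofReal (2 * (1 + ∫ x, K x)) * ENNReal.ofReal b := by
  have hI : 0 ≤ ∫ x, K x := integral_nonneg hK.nonneg
  refine (tsum_int_le_of_even fun k => ?_).trans ?_
  · push_cast
    rw [neg_div, hK.symm]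
  · have h2 : ∑' n : ℕ, ‖K (((n : ℤ) : ℝ) / b)‖ₑ ≤ ENNReal.ofReal ((1 + ∫ x, K x) * b) := by
      refine ENNReal.tsum_le_of_sum_range_le fun n => ?_
      calc ∑ i ∈ Finset.range n, ‖K (((i : ℤ) : ℝ) / b)‖ₑ
          ≤ ∑ i ∈ Finset.range (n + 1), ‖K (((i : ℤ) : ℝ) / b)‖ₑ :=
            Finset.sum_le_sum_of_subset (Finset.range_mono (Nat.le_succ n))
        _ = ENNReal.ofReal (∑ i ∈ Finset.range (n + 1), K ((i : ℝ) / b)) := by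
            rw [ENNReal.ofReal_sum_of_nonneg fun i _ => hK.nonneg _]
            exact Finset.sum_congr rfl fun i _ => by
              rw [Real.enorm_eq_ofReal (hK.nonneg _), Int.cast_natCast]
        _ ≤ _ := by
            refine ENNReal.ofReal_le_ofReal ?_
            rw [Finset.sum_range_succ']
            have := hK.sum_range_le (by linarith : 0 < b) n
            simp only [Nat.cast_zero, zero_div, hK.map_zero]
            nlinarith
    calc _ ≤ 2 * ENNReal.ofReal ((1 + ∫ x, K x) * b) := by gcongr
      _ = _ := by
        rw [← ENNReal.ofReal_ofNat, ← ENNReal.ofReal_mul (by norm_num),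
          ← ENNReal.ofReal_mul (by positivity)]
        congr 1
        ring

end KernelAssumption

/-- The polynomially decaying coefficients `C (1 + k) ^ (-α)`, `k ≥ 0`. -/
noncomputable def polyDecay (C α : ℝ) (k : ℤ) : ℝ≥0∞ :=
  if k < 0 then 0 else ENNReal.ofReal (C * (1 + (k : ℝ)) ^ (-α))

section PolyDecay

variable {C α : ℝ}

lemma decay_polyDecay (hC : 0 ≤ C) (hα : 0 ≤ α) : Decay (polyDecay C α) where
  neg k hk := by simp [polyDecay, hk]
  anti k l hk hkl := by
    rw [polyDecay, polyDecay, if_neg (by omega), if_neg (by omega)]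
    have hk' : (0 : ℝ) ≤ k := by exact_mod_cast hk
    have hkl' : (k : ℝ) ≤ l := by exact_mod_cast hkl
    refine ENNReal.ofReal_le_ofReal (mul_le_mul_of_nonneg_left ?_ hC)
    exact Real.rpow_le_rpow_of_nonpos (by linarith) (by linarith) (by linarith)

lemma summable_one_add_rpow {p : ℝ} (hp : p < -1) : Summable fun n : ℕ => (1 + (n : ℝ)) ^ p := by
  have := (summable_nat_add_iff 1).2 (Real.summable_nat_rpow.2 hp)
  refine this.congr fun n => ?_
  push_cast
  rw [add_comm]

lemma tsum_polyDecay_ne_top (hα : 1 < α) : ∑' k, polyDecay C α k ≠ ∞ := by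
  rw [tsum_int_eq]
  have h1 : ∀ n : ℕ, polyDecay C α (-(n + 1 : ℤ)) = 0 := fun n => by
    rw [polyDecay, if_pos (by omega)]
  have h2 : ∀ n : ℕ, polyDecay C α n = ENNReal.ofReal (C * (1 + (n : ℝ)) ^ (-α)) := fun n => by
    rw [polyDecay, if_neg (by omega), Int.cast_natCast]
  simp_rw [h1, h2, tsum_zero, add_zero]
  exact ((summable_one_add_rpow (by linarith)).mul_left C).tsum_ofReal_ne_top

lemma firstMoment_polyDecay_ne_top (hC : 0 ≤ C) (hα : 2 < α) :
    ShortMemory.firstMoment (polyDecay C α) ≠ ∞ := by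
  have hs : Summable fun n : ℕ => C * 2 ^ α * (1 + (n : ℝ)) ^ (1 - α) :=
    (summable_one_add_rpow (by linarith)).mul_left _
  refine ne_top_of_le_ne_top (ENNReal.mul_ne_top (ENNReal.ofNat_ne_top (n := 2)) hs.tsum_ofReal_ne_top)
    ((tsum_int_le_of_even fun k => by rw [Int.natAbs_neg, abs_neg]).trans ?_)
  gcongr with n
  rw [Int.natAbs_natCast, Nat.abs_cast, polyDecay, if_neg (by omega), ← ENNReal.ofReal_natCast,
    ← ENNReal.ofReal_mul (by positivity)]
  refine ENNReal.ofReal_le_ofReal ?_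
  -- Halving the argument costs only a factor 2^α, so the terms are O(n^{1-α}), summable for α > 2.
  have h1 : (1 + (n : ℝ)) / 2 ≤ 1 + (((n : ℤ) / 2 : ℤ) : ℝ) := by
    have : (n : ℤ) ≤ 2 * ((n : ℤ) / 2) + 1 := by omega
    have : (n : ℝ) ≤ 2 * (((n : ℤ) / 2 : ℤ) : ℝ) + 1 := by exact_mod_cast this
    linarith
  have h2 : (1 + (((n : ℤ) / 2 : ℤ) : ℝ)) ^ (-α) ≤ ((1 + (n : ℝ)) / 2) ^ (-α) :=
    Real.rpow_le_rpow_of_nonpos (by positivity) h1 (by linarith)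
  calc (n : ℝ) * (C * (1 + (((n : ℤ) / 2 : ℤ) : ℝ)) ^ (-α))
      ≤ (1 + (n : ℝ)) * (C * ((1 + (n : ℝ)) / 2) ^ (-α)) := by
        gcongr
        linarith
    _ = _ := by
        rw [Real.div_rpow (by positivity) (by norm_num), Real.rpow_neg (by norm_num : (0:ℝ) ≤ 2),
          div_inv_eq_mul, sub_eq_add_neg, Real.rpow_add (by positivity), Real.rpow_one]
        ring

end PolyDecay

end LagWindow

/-! ### Transfer from the probability space to the sequence space. -/

namespace LagWindow

/-- The causal process `g(e_t, e_{t-1}, …)` up to time `T`, as a function of the innovations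
listed backwards from time `T`. -/
def causalShift {α : Type*} (g : (ℕ → α) → ℝ) (T t : ℤ) (x : ℕ → α) : ℝ :=
  g (fun i => x ((T - t).toNat + i))

set_option linter.unusedSectionVars false

namespace ProcessAssumption

variable {Ω : Type*} [MeasurableSpace Ω] {P : Measure Ω} [IsProbabilityMeasure P]
  {e : ℤ → Ω → ℝ} {g : (ℕ → ℝ) → ℝ} {X : ℤ → Ω → ℝ} {m : ℝ}

lemma isProbabilityMeasure_map_e (hX : ProcessAssumption P e g X m) :
    IsProbabilityMeasure (P.map (e 0)) :=
  Measure.isProbabilityMeasure_map (hX.measurable_e 0).aemeasurable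

lemma measurePreserving_past (hX : ProcessAssumption P e g X m) (T : ℤ) :
    MeasurePreserving (past e T) P (seqLaw (P.map (e 0))) := by
  have hmeas : ∀ i : ℕ, Measurable (e (T - (i : ℤ))) := fun i => hX.measurable_e _
  refine ⟨measurable_pi_lambda _ hmeas, ?_⟩
  have hind : iIndepFun (fun i : ℕ => e (T - (i : ℤ))) P :=
    hX.indep_e.precomp (g := fun i : ℕ => T - (i : ℤ)) fun a b h => by simpa using h
  have := hind.map_fun_eq_infinitePi_map hmeas
  simp_rw [(hX.identDistrib_e _).map_eq] at this
  exact this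

lemma causalShift_past {T t : ℤ} (ht : t ≤ T) (ω : Ω) :
    causalShift g T t (past e T ω) = g (past e t ω) := by
  unfold causalShift past
  congr 1
  funext i
  congr 1
  push_cast
  rw [Int.toNat_of_nonneg (by omega)]
  ring

lemma integral_comp_past (hX : ProcessAssumption P e g X m) (T : ℤ) {F : (ℕ → ℝ) → ℝ}
    (hF : Measurable F) :
    ∫ x, F x ∂(seqLaw (P.map (e 0))) = ∫ ω, F (past e T ω) ∂P := by
  rw [← (hX.measurePreserving_past T).map_eq,
    integral_map (hX.measurePreserving_past T).measurable.aemeasurable hF.aestronglyMeasurable]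

lemma ae_eq_causalShift (hX : ProcessAssumption P e g X m) {T t : ℤ} (ht : t ≤ T) :
    X t =ᵐ[P] fun ω => causalShift g T t (past e T ω) := by
  filter_upwards [hX.repr_X t] with ω hω
  rw [hω, causalShift_past ht]

lemma measurable_causalShift (hX : ProcessAssumption P e g X m) (T t : ℤ) :
    Measurable (causalShift g T t) :=
  hX.measurable_g.comp (by fun_prop)

lemma eLpNorm_X (hX : ProcessAssumption P e g X m) (t : ℤ) (p : ℝ≥0∞) :
    eLpNorm (X t) p P = eLpNorm (X 0) p P := by
  have := hX.isProbabilityMeasure_map_e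
  have h : ∀ t, eLpNorm (X t) p P = eLpNorm g p (seqLaw (P.map (e 0))) := fun t => by
    rw [eLpNorm_congr_ae (hX.repr_X t)]
    exact eLpNorm_comp_measurePreserving hX.measurable_g.aestronglyMeasurable
      (hX.measurePreserving_past t)
  rw [h, h]

/-- Stationarity with shift t - j moves the pair of times (t - j, t) to (0, j). -/
lemma integral_mul_eq_autocov (hX : ProcessAssumption P e g X m) (t : ℤ) (j : ℕ) :
    ∫ ω, X t ω * X (t - j) ω ∂P = autocov P X j := by
  have h := hX.stationary_X (t - j)
  have hm : ∀ s : ℤ, Measurable (fun ω (u : ℤ) => X (u + s) ω) := fun s =>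
    measurable_pi_lambda _ fun u => hX.measurable_X _
  have hm0 : Measurable (fun ω (u : ℤ) => X u ω) := measurable_pi_lambda _ hX.measurable_X
  have hF : Measurable (fun z : ℤ → ℝ => z 0 * z j) := by fun_prop
  have h1 := integral_map (μ := P) (hm (t - j)).aemeasurable hF.aestronglyMeasurable
  have h2 := integral_map (μ := P) hm0.aemeasurable hF.aestronglyMeasurable
  rw [h, h2] at h1
  simp only [autocov, covariance, hX.centered_X, sub_zero]
  rw [h1]
  congr 1
  funext ω
  simp only [add_sub_cancel, zero_add]
  rw [mul_comm]

/-- Coordinate `n` is the innovation at time T - n. If that time is after `t`, resampling has no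
effect; otherwise it is the innovation at lag k = t - T + n, and the resampling norm is exactly
δ_m(k). -/
lemma resampleNorm_causalShift_le (hX : ProcessAssumption P e g X m) {C α : ℝ}
    (hδ : ∀ (t : ℤ) (k : ℕ), delta P e g X m t k ≤ ENNReal.ofReal (C * (1 + (k : ℝ)) ^ (-α)))
    {T t : ℤ} (ht : t ≤ T) (n : ℕ) :
    resampleNorm (P.map (e 0)) m (causalShift g T t) n ≤ polyDecay C α (t - T + n) := by
  have := hX.isProbabilityMeasure_map_e
  rcases lt_or_ge n (T - t).toNat with hn | hn
  · have h0 : ∀ p : (ℕ → ℝ) × (ℕ → ℝ), causalShift g T t p.1 -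
        causalShift g T t (Function.update p.1 n (p.2 n)) = 0 := fun p => by
      rw [sub_eq_zero]
      unfold causalShift
      congr 1
      funext i
      rw [Function.update_of_ne (by omega)]
    simp [resampleNorm, h0]
  · obtain ⟨k, rfl⟩ := Nat.exists_eq_add_of_le hn
    have hk : t - T + ((T - t).toNat + k : ℕ) = (k : ℤ) := by
      push_cast
      rw [Int.toNat_of_nonneg (by omega)]
      ring
    rw [hk, polyDecay, if_neg (by omega), Int.cast_natCast]
    refine le_trans (le_of_eq ?_) (hδ t k)
    have hp := (hX.measurePreserving_past T).prod (hX.measurePreserving_past T)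
    have hmeas : Measurable (fun p : (ℕ → ℝ) × (ℕ → ℝ) => causalShift g T t p.1 -
        causalShift g T t (Function.update p.1 ((T - t).toNat + k) (p.2 ((T - t).toNat + k)))) :=
      ((hX.measurable_causalShift T t).comp measurable_fst).sub
        ((hX.measurable_causalShift T t).comp (measurePreserving_resample (P.map (e 0)) _).measurable)
    rw [resampleNorm, ← eLpNorm_comp_measurePreserving hmeas.aestronglyMeasurable hp, delta]
    refine eLpNorm_congr_ae ?_
    have hfst : ∀ᵐ p ∂(P.prod P), X t p.1 = causalShift g T t (past e T p.1) :=
      (measurePreserving_fst (μ := P) (ν := P)).quasiMeasurePreserving.ae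
        (hX.ae_eq_causalShift ht)
    filter_upwards [hfst] with p hp1
    simp only [Function.comp, Prod.map_fst, Prod.map_snd]
    rw [hp1]
    congr 1
    unfold causalShift
    congr 1
    funext i
    simp only [Function.update_apply, past]
    have h3 : ∀ l : ℕ, T - (((T - t).toNat + l : ℕ) : ℤ) = t - l := fun l => by
      push_cast
      rw [Int.toNat_of_nonneg (by omega)]
      ring
    by_cases hik : i = k
    · subst hik
      simp only [if_true, h3]
    · rw [if_neg (by omega), if_neg hik, h3]

/-- The order of quantifiers matters: `A` and `θ` are fixed before `T`, so all later constants are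
uniform in the sample size. -/
lemma exists_shortMemory (hX : ProcessAssumption P e g X m) :
    ∃ (A : ℝ≥0∞) (θ : ℤ → ℝ≥0∞), A ≠ ∞ ∧ ∑' k, θ k ≠ ∞ ∧ ShortMemory.firstMoment θ ≠ ∞ ∧
      ∀ [IsProbabilityMeasure (P.map (e 0))] (T : ℤ),
        ShortMemory (P.map (e 0)) m T A θ (causalShift g T) (autocov P X) := by
  obtain ⟨α, hα, C, hδ⟩ := hX.delta_le
  -- No sign is known for `C`, and monotonicity of the coefficients needs a nonnegative constant.
  have hδ' : ∀ (t : ℤ) (k : ℕ), delta P e g X m t k ≤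
      ENNReal.ofReal (max C 0 * (1 + (k : ℝ)) ^ (-α)) := fun t k =>
    (hδ t k).trans (ENNReal.ofReal_le_ofReal (by gcongr; exact le_max_left _ _))
  have hA : eLpNorm (X 0) (ENNReal.ofReal m) P ≠ ∞ := (hX.memLp_X 0).2.ne
  refine ⟨eLpNorm (X 0) (ENNReal.ofReal m) P, polyDecay (max C 0) α, hA,
    tsum_polyDecay_ne_top (by linarith),
    firstMoment_polyDecay_ne_top (le_max_right _ _) (by linarith), fun T => ?_⟩
  have hpast := hX.measurePreserving_past T
  refine ⟨fun t ht => ⟨hX.measurable_causalShift T t, ?_,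
      hX.resampleNorm_causalShift_le hδ' ht⟩, fun t ht => ?_, fun t ht j => ?_,
    decay_polyDecay (le_max_right _ _) (by linarith), tsum_polyDecay_ne_top (by linarith), hA,
    hX.m_gt⟩
  · rw [← eLpNorm_comp_measurePreserving (hX.measurable_causalShift T t).aestronglyMeasurable
      hpast, ← hX.eLpNorm_X t]
    exact (eLpNorm_congr_ae (hX.ae_eq_causalShift ht)).ge
  · rw [hX.integral_comp_past T (hX.measurable_causalShift T t), ← hX.centered_X t]
    exact integral_congr_ae (hX.ae_eq_causalShift ht).symm
  · have hF : Measurable (fun x => causalShift g T t x * causalShift g T (t - j) x) :=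
      (hX.measurable_causalShift T t).mul (hX.measurable_causalShift T (t - j))
    rw [hX.integral_comp_past T hF, ← hX.integral_mul_eq_autocov t j]
    refine integral_congr_ae ?_
    filter_upwards [hX.ae_eq_causalShift ht,
      hX.ae_eq_causalShift (T := T) (t := t - j) (by omega)] with ω h1 h2
    rw [h1, h2]

lemma sampleAutocov_congr {Ω' : Type*} [MeasurableSpace Ω'] {X : ℤ → Ω → ℝ} {Z : ℤ → Ω' → ℝ}
    {T : ℕ} {ω : Ω} {x : Ω'} (h : ∀ t ≤ (T : ℤ), X t ω = Z t x) (j : ℕ) :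
    sampleAutocov X T j ω = sampleAutocov Z T j x := by
  unfold sampleAutocov
  congr 1
  refine Finset.sum_congr rfl fun t ht => ?_
  have ht' : (t : ℤ) ≤ T := by exact_mod_cast (Finset.mem_Icc.1 ht).2
  rw [h t ht', h (t - j) (by omega)]

lemma sigmaHat_congr {Ω' : Type*} [MeasurableSpace Ω'] {X : ℤ → Ω → ℝ} {Z : ℤ → Ω' → ℝ}
    {T : ℕ} {ω : Ω} {x : Ω'} (h : ∀ t ≤ (T : ℤ), X t ω = Z t x) (K : ℝ → ℝ) (b : ℝ) (j₁ j₂ : ℕ) :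
    sigmaHat K b X T j₁ j₂ ω = sigmaHat K b Z T j₁ j₂ x := by
  unfold sigmaHat
  rw [sampleAutocov_congr h, sampleAutocov_congr h]
  congr 1
  refine Finset.sum_congr rfl fun t ht => Finset.sum_congr rfl fun s hs => ?_
  have ht' : (t : ℤ) ≤ T := by exact_mod_cast (Finset.mem_Icc.1 ht).2
  have hs' : (s : ℤ) ≤ T := by exact_mod_cast (Finset.mem_Icc.1 hs).2
  rw [h t ht', h (t - j₁) (by omega), h s hs', h (s - j₂) (by omega)]

lemma measurable_sigmaHat (hX : ProcessAssumption P e g X m) (K : ℝ → ℝ) (b : ℝ) (T j₁ j₂ : ℕ) :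
    Measurable (sigmaHat K b X T j₁ j₂) := by
  have h0 : ∀ j, Measurable (sampleAutocov X T j) := fun j =>
    Measurable.const_mul (Finset.measurable_fun_sum _ fun t _ =>
      (hX.measurable_X _).mul (hX.measurable_X _)) _
  refine Measurable.const_mul (Finset.measurable_fun_sum _ fun t _ =>
    Finset.measurable_fun_sum _ fun s _ => ?_) _
  exact (Measurable.const_mul (((hX.measurable_X _).mul (hX.measurable_X _)).sub (h0 _)) _).mul
    (((hX.measurable_X _).mul (hX.measurable_X _)).sub (h0 _))

lemma sigmaT_eq (hX : ProcessAssumption P e g X m) (T j₁ j₂ : ℕ) :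
    sigmaT P X T j₁ j₂ = (1 / (T : ℝ)) * ∑ t ∈ Finset.Icc (j₁ + 1) T, ∑ s ∈ Finset.Icc (j₂ + 1) T,
      ∫ x, (causalShift g T t x * causalShift g T (t - j₁) x - autocov P X j₁) *
        (causalShift g T s x * causalShift g T (s - j₂) x - autocov P X j₂)
          ∂(seqLaw (P.map (e 0))) := by
  have hm := hX.measurable_causalShift T
  unfold sigmaT
  congr 1
  refine Finset.sum_congr rfl fun t ht => Finset.sum_congr rfl fun s hs => ?_
  have ht' : (t : ℤ) ≤ T := by exact_mod_cast (Finset.mem_Icc.1 ht).2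
  have hs' : (s : ℤ) ≤ T := by exact_mod_cast (Finset.mem_Icc.1 hs).2
  have hF : Measurable (fun x =>
      (causalShift g T t x * causalShift g T (t - j₁) x - autocov P X j₁) *
        (causalShift g T s x * causalShift g T (s - j₂) x - autocov P X j₂)) :=
    (((hm _).mul (hm _)).sub_const _).mul (((hm _).mul (hm _)).sub_const _)
  rw [hX.integral_comp_past T hF]
  refine integral_congr_ae ?_
  filter_upwards [hX.ae_eq_causalShift ht', hX.ae_eq_causalShift hs',
    hX.ae_eq_causalShift (T := T) (t := t - j₁) (by omega),
    hX.ae_eq_causalShift (T := T) (t := s - j₂) (by omega)] with ω h1 h2 h3 h4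
  rw [h1, h2, h3, h4]

/-- The estimator is close in `L^{m/4}` to a deterministic quantity which is close to its target,
uniformly in the lags. -/
theorem exists_sigmaHat_bound (hX : ProcessAssumption P e g X m) {K : ℝ → ℝ}
    (hK : KernelAssumption K) :
    ∃ C₁ C₂ : ℝ, 0 ≤ C₁ ∧ 0 ≤ C₂ ∧ ∀ (T : ℕ) (b : ℝ), 0 < T → 1 ≤ b → ∀ j₁ j₂ : ℕ, ∃ s : ℝ,
      eLpNorm (fun ω => sigmaHat K b X T j₁ j₂ ω - s) (ENNReal.ofReal (m / 4)) P ≤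
        ENNReal.ofReal (C₁ * (b / Real.sqrt T)) ∧
      |s - sigmaT P X T j₁ j₂| ≤ C₂ / b := by
  have hprob := hX.isProbabilityMeasure_map_e
  have hm := hX.m_gt
  obtain ⟨A, θ, hA, hθ, hW, hS⟩ := hX.exists_shortMemory
  obtain ⟨D₂, hD₂t, hD₂⟩ := exists_eLpNorm_sub_integral_le.{0} (q := m / 2) (by linarith)
  obtain ⟨D₄, hD₄t, hD₄⟩ := exists_eLpNorm_sub_integral_le.{0} (q := m / 4) (by linarith)
  obtain ⟨L, hL, hKL⟩ := hK.exists_abs_sub_one_le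
  set E := ShortMemory.estimatorConst A θ D₂ D₄ * ENNReal.ofReal (2 * (1 + ∫ x, K x)) with hE
  have hEt : E ≠ ∞ := by
    simp only [hE, ShortMemory.estimatorConst, ShortMemory.autocovConst]
    finiteness
  set F := 4 * (A * A) * (∑' k, θ k) * ShortMemory.firstMoment θ with hF
  have hFt : F ≠ ∞ := by
    simp only [hF]
    finiteness
  refine ⟨E.toReal, F.toReal * L, by positivity, by positivity, fun T b hT hb j₁ j₂ => ?_⟩
  have hb0 : 0 < b := by linarith
  have hTr : (0 : ℝ) < T := by exact_mod_cast hT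
  -- For a lag beyond the sample both the estimator and its target are empty sums.
  rcases lt_or_ge T j₁ with hj₁ | hj₁
  · refine ⟨0, ?_, ?_⟩
    · simp [sigmaHat, Finset.Icc_eq_empty_of_lt (by omega : T < j₁ + 1)]
    · simp only [sigmaT, Finset.Icc_eq_empty_of_lt (by omega : T < j₁ + 1), Finset.sum_empty,
        mul_zero, sub_zero, abs_zero]
      positivity
  rcases lt_or_ge T j₂ with hj₂ | hj₂
  · refine ⟨0, ?_, ?_⟩
    · simp [sigmaHat, Finset.Icc_eq_empty_of_lt (by omega : T < j₂ + 1)]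
    · simp only [sigmaT, Finset.Icc_eq_empty_of_lt (by omega : T < j₂ + 1), Finset.sum_empty,
        Finset.sum_const_zero, mul_zero, sub_zero, abs_zero]
      positivity
  have h := hS (T : ℤ)
  set Z := causalShift g (T : ℤ) with hZ
  set w : ℕ → ℕ → ℝ := fun t s => K (((t : ℝ) - (s : ℝ)) / b) with hw
  -- The centering is the mean of the quadratic form with the true autocovariances, not the mean of
  -- the estimator.
  set s₀ : ℝ := (1 / (T : ℝ)) * ∑ t ∈ Finset.Icc (j₁ + 1) T, ∑ s ∈ Finset.Icc (j₂ + 1) T, w t s *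
    ∫ x, (Z t x * Z (t - j₁) x - autocov P X j₁) * (Z s x * Z (s - j₂) x - autocov P X j₂)
      ∂(seqLaw (P.map (e 0))) with hs₀
  have hτ : ENNReal.ofReal (Real.sqrt T) ^ 2 = T := by
    rw [← ENNReal.ofReal_pow (Real.sqrt_nonneg _), Real.sq_sqrt hTr.le, ENNReal.ofReal_natCast]
  have hτ1 : 1 ≤ ENNReal.ofReal (Real.sqrt T) := by
    rw [ENNReal.one_le_ofReal, Real.one_le_sqrt]
    exact_mod_cast hT
  have hcol : ∀ s, ∑ t ∈ Finset.Icc (j₁ + 1) T, ‖w t s‖ₑ ≤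
      ENNReal.ofReal (2 * (1 + ∫ x, K x)) * ENNReal.ofReal b := fun s => by
    refine le_trans ?_ (hK.tsum_enorm_le hb)
    refine le_trans (ENNReal.sum_le_tsum _) (le_trans (le_of_eq ?_)
      (ENNReal.tsum_comp_le_tsum_of_injective (f := fun t : ℕ => (t : ℤ) - s)
        (fun a b h => by simpa using h) (fun k : ℤ => ‖K ((k : ℝ) / b)‖ₑ)))
    simp [hw]
  have hsymm : ∀ t s, w t s = w s t := fun t s => by
    simp only [hw]
    rw [← hK.symm, ← neg_div, neg_sub]
  have hrow : ∀ t, ∑ s ∈ Finset.Icc (j₂ + 1) T, ‖w t s‖ₑ ≤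
      ENNReal.ofReal (2 * (1 + ∫ x, K x)) * ENNReal.ofReal b := fun t => by
    refine le_trans ?_ (hK.tsum_enorm_le hb)
    refine le_trans (ENNReal.sum_le_tsum _) (le_trans (le_of_eq ?_)
      (ENNReal.tsum_comp_le_tsum_of_injective (f := fun s : ℕ => (s : ℤ) - t)
        (fun a b h => by simpa using h) (fun k : ℤ => ‖K ((k : ℝ) / b)‖ₑ)))
    simp_rw [hsymm t]
    simp [hw]
  refine ⟨s₀, ?_, ?_⟩
  · have hall : ∀ᵐ ω ∂P, ∀ t ≤ (T : ℤ), X t ω = Z t (past e T ω) := by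
      rw [ae_all_iff]
      intro t
      by_cases ht : t ≤ (T : ℤ)
      · filter_upwards [hX.ae_eq_causalShift ht] with ω hω _ using hω
      · exact ae_of_all _ fun ω ht' => absurd ht' ht
    have hae : (fun ω => sigmaHat K b X T j₁ j₂ ω - s₀) =ᵐ[P]
        (fun x => sigmaHat K b Z T j₁ j₂ x - s₀) ∘ past e T := by
      filter_upwards [hall] with ω hω
      simp only [Function.comp, sigmaHat_congr hω]
    have hbound := h.eLpNorm_estimator_sub_le hj₁ hj₂ hT (fun f B a => hD₂ (P.map (e 0)) f B a)
      (fun f B a => hD₄ (P.map (e 0)) f B a) hτ hτ1 hrow hcol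
    have hmeas : Measurable (sigmaHat K b Z T j₁ j₂) := by
      refine Measurable.const_mul (Finset.measurable_fun_sum _ fun t ht =>
        Finset.measurable_fun_sum _ fun s hs => ?_) _
      have hz := hX.measurable_causalShift (T : ℤ)
      exact (Measurable.const_mul (((hz _).mul (hz _)).sub (h.measurable_sampleAutocov _)) _).mul
        (((hz _).mul (hz _)).sub (h.measurable_sampleAutocov _))
    rw [eLpNorm_congr_ae hae, eLpNorm_comp_measurePreserving
      (hmeas.sub_const s₀).aestronglyMeasurable (hX.measurePreserving_past T)]
    refine hbound.trans (le_of_eq ?_)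
    calc _ = E * (ENNReal.ofReal b * (‖1 / (T : ℝ)‖ₑ * ENNReal.ofReal (Real.sqrt T))) := by
          rw [hE]; ring
      _ = ENNReal.ofReal (E.toReal * (b * ((1 / (T : ℝ)) * Real.sqrt T))) := by
          rw [ENNReal.ofReal_mul ENNReal.toReal_nonneg, ENNReal.ofReal_toReal hEt,
            ENNReal.ofReal_mul hb0.le, ENNReal.ofReal_mul (by positivity),
            Real.enorm_eq_ofReal (by positivity)]
      _ = _ := by
          congr 2
          have hsq : Real.sqrt T ≠ 0 := (Real.sqrt_pos.2 hTr).ne'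
          have h2 : (T : ℝ) = Real.sqrt T * Real.sqrt T := (Real.mul_self_sqrt hTr.le).symm
          conv_lhs => rw [h2]
          simp only [Real.sqrt_mul_self (Real.sqrt_nonneg _)]
          field_simp
  · have hl : ∀ t s : ℕ, ‖w t s - 1‖ₑ ≤ ENNReal.ofReal (L / b) * (((t : ℤ) - s).natAbs : ℝ≥0∞) :=
      fun t s => by
        rw [Real.enorm_eq_ofReal_abs, ← ENNReal.ofReal_natCast,
          ← ENNReal.ofReal_mul (by positivity)]
        refine ENNReal.ofReal_le_ofReal ((hKL _).trans_eq ?_)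
        rw [abs_div, abs_of_pos hb0, Nat.cast_natAbs]
        push_cast
        ring
    have hbias := h.enorm_bias_le j₁ j₂ hT hl
    rw [← hX.sigmaT_eq] at hbias
    rw [Real.enorm_eq_ofReal_abs] at hbias
    have h3 : F * ENNReal.ofReal (L / b) = ENNReal.ofReal (F.toReal * L / b) := by
      rw [mul_div_assoc, ENNReal.ofReal_mul ENNReal.toReal_nonneg, ENNReal.ofReal_toReal hFt]
    rw [h3, ENNReal.ofReal_le_ofReal_iff (by positivity)] at hbias
    exact hbias

end ProcessAssumption

end LagWindow

/-! ### Union bound over the lags. -/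

theorem proposition1 {Ω : Type*} [MeasurableSpace Ω] (P : Measure Ω) [IsProbabilityMeasure P]
    (e : ℤ → Ω → ℝ) (g : (ℕ → ℝ) → ℝ) (X : ℤ → Ω → ℝ) (m : ℝ)
    (hX : LagWindow.ProcessAssumption P e g X m)
    (K : ℝ → ℝ) (hK : LagWindow.KernelAssumption K)
    (M : ℕ → ℕ) (a_s : ℝ) (ha : 0 < a_s)
    (hM : (fun T : ℕ => (M T : ℝ)) =Θ[atTop] (fun T : ℕ => (T : ℝ) ^ a_s))
    (b : ℕ → ℝ) (c : ℝ) (hb_pos : ∀ T, 0 < b T) (hb_top : Tendsto b atTop atTop)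
    (hb : b =Θ[atTop] (fun T : ℕ => (T : ℝ) ^ c))
    (hc : c < 1 / 2 - 8 * a_s / m) :
    LagWindow.IsBigOP P
      (fun (T : ℕ) (ω : Ω) => LagWindow.supError P K (b T) X T (M T) ω)
      (fun T : ℕ => 1 / b T + b T * (M T : ℝ) ^ (8 / m) / Real.sqrt (T : ℝ)) := by
  have hm := hX.m_gt
  obtain ⟨C₁, C₂, hC₁, hC₂, hbd⟩ := hX.exists_sigmaHat_bound hK
  intro ε hε
  set q := m / 4 with hq
  have hq0 : 0 < q := by positivity
  -- C ≥ C₂ covers the bias, the last summand makes (C₁/C)^q at most ε in Markov's inequality, and 1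
  -- keeps C positive.
  set C := 1 + C₂ + C₁ * ε ^ (-(1 / q)) with hC
  have hCpos : 0 < C := by positivity
  refine ⟨C, hCpos, ?_⟩
  filter_upwards [hb_top.eventually_ge_atTop 1, eventually_gt_atTop 0] with T hbT hT
  have hTr : (0 : ℝ) < T := by exact_mod_cast hT
  set r := b T / Real.sqrt T with hr
  have hr0 : 0 < r := div_pos (hb_pos T) (Real.sqrt_pos.2 hTr)
  choose s hs₁ hs₂ using fun j₁ j₂ => hbd T (b T) hT hbT j₁ j₂
  set lam : ℝ := C * (r * (M T : ℝ) ^ (8 / m)) with hlam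
  have hlam0 : 0 ≤ lam := by positivity
  set S := Finset.Icc 1 (M T) ×ˢ Finset.Icc 1 (M T) with hS
  have hsub : {ω | C * (1 / b T + b T * (M T : ℝ) ^ (8 / m) / Real.sqrt T) <
      |LagWindow.supError P K (b T) X T (M T) ω|} ⊆
      ⋃ p ∈ S, {ω | ENNReal.ofReal lam ≤
        ‖LagWindow.sigmaHat K (b T) X T p.1 p.2 ω - s p.1 p.2‖ₑ} := by
    intro ω hω
    simp only [Set.mem_ofPred_eq] at hω
    by_contra hcon
    simp only [Set.mem_iUnion, Set.mem_ofPred_eq, not_exists, not_le] at hcon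
    refine hω.not_ge ?_
    have hbp := hb_pos T
    rw [LagWindow.supError, abs_of_nonneg (Real.iSup_nonneg fun _ => abs_nonneg _)]
    -- Nonnegativity of the bound takes care of an empty index set, over which the supremum is 0.
    refine Real.iSup_le (fun p => ?_) (by positivity)
    have h1 := hcon p.1 p.2
    rw [Real.enorm_eq_ofReal_abs, ENNReal.ofReal_lt_ofReal_iff_of_nonneg (abs_nonneg _)] at h1
    have h2 := hs₂ p.1.1 p.1.2
    have h3 : C₂ / b T ≤ C * (1 / b T) := by
      rw [mul_one_div]
      gcongr
      have : 0 ≤ C₁ * ε ^ (-(1 / q)) := by positivity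
      linarith
    have h4 : lam = C * (b T * (M T : ℝ) ^ (8 / m) / Real.sqrt T) := by
      rw [hlam, hr]; ring
    calc _ ≤ |LagWindow.sigmaHat K (b T) X T p.1.1 p.1.2 ω - s p.1.1 p.1.2| +
          |s p.1.1 p.1.2 - LagWindow.sigmaT P X T p.1.1 p.1.2| := abs_sub_le _ _ _
      _ ≤ lam + C * (1 / b T) := add_le_add h1.le (h2.trans h3)
      _ = _ := by rw [h4]; ring
  have hpair : ∀ p ∈ S, P {ω | ENNReal.ofReal lam ≤
      ‖LagWindow.sigmaHat K (b T) X T p.1 p.2 ω - s p.1 p.2‖ₑ} ≤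
      ENNReal.ofReal (ε / (M T : ℝ) ^ 2) := by
    intro p hp
    have hM1 : 1 ≤ M T := by
      have := Finset.mem_Icc.1 (Finset.mem_product.1 hp).1
      omega
    have hMr : (0 : ℝ) < M T := by exact_mod_cast hM1
    have hlampos : 0 < lam := by positivity
    have hmark := meas_ge_le_mul_pow_eLpNorm_enorm P (p := ENNReal.ofReal q)
      (by simpa using hq0) ENNReal.ofReal_ne_top
      ((hX.measurable_sigmaHat K (b T) T p.1 p.2).sub_const (s p.1 p.2)).aestronglyMeasurable
      (ε := ENNReal.ofReal lam) (by simpa using hlampos)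
      (fun h => absurd h ENNReal.ofReal_ne_top)
    refine hmark.trans ?_
    rw [ENNReal.toReal_ofReal hq0.le]
    refine (mul_le_mul_right (ENNReal.rpow_le_rpow (hs₁ p.1 p.2) hq0.le) _).trans ?_
    rw [← ENNReal.ofReal_inv_of_pos hlampos, ← ENNReal.mul_rpow_of_nonneg _ _ hq0.le,
      ← ENNReal.ofReal_mul (by positivity), ENNReal.ofReal_rpow_of_nonneg (by positivity) hq0.le]
    refine ENNReal.ofReal_le_ofReal ?_
    have e1 : lam⁻¹ * (C₁ * r) = (C₁ / C) * ((M T : ℝ) ^ (8 / m))⁻¹ := by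
      rw [hlam]; field_simp
    -- Since (8/m)(m/4) = 2, the threshold is just large enough to pay for the M_T² pairs of lags.
    have e2 : (((M T : ℝ) ^ (8 / m))⁻¹) ^ q = ((M T : ℝ) ^ 2)⁻¹ := by
      rw [Real.inv_rpow (by positivity), ← Real.rpow_mul hMr.le]
      congr 1
      rw [← Real.rpow_natCast]
      congr 1
      rw [hq]
      push_cast
      field_simp
      norm_num
    have e3 : (C₁ / C) ^ q ≤ ε := by
      have h1 : C₁ / C ≤ ε ^ (1 / q) := by
        rw [div_le_iff₀ hCpos, hC]
        have h2 : ε ^ (1 / q) * (C₁ * ε ^ (-(1 / q))) = C₁ := by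
          rw [mul_left_comm, ← Real.rpow_add hε, add_neg_cancel, Real.rpow_zero, mul_one]
        have h3 : 0 ≤ ε ^ (1 / q) * (1 + C₂) := by positivity
        nlinarith
      calc (C₁ / C) ^ q ≤ (ε ^ (1 / q)) ^ q := by gcongr
        _ = ε := by
          rw [← Real.rpow_mul hε.le, one_div_mul_cancel hq0.ne', Real.rpow_one]
    rw [e1, Real.mul_rpow (by positivity) (by positivity), e2, div_eq_mul_inv]
    exact mul_le_mul_of_nonneg_right e3 (by positivity)
  refine (measure_mono hsub).trans ((measure_biUnion_finset_le S _).trans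
    ((Finset.sum_le_card_nsmul S _ _ hpair).trans ?_))
  rw [nsmul_eq_mul, ← ENNReal.ofReal_natCast, ← ENNReal.ofReal_mul (by positivity)]
  refine ENNReal.ofReal_le_ofReal ?_
  rw [hS, Finset.card_product, Nat.card_Icc, Nat.add_sub_cancel]
  rcases Nat.eq_zero_or_pos (M T) with h0 | h0
  · simp [h0, hε.le]
  · have : (0 : ℝ) < M T := by exact_mod_cast h0
    push_cast
    refine le_of_eq ?_
    field_simp
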